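/- **Setting.** Let $\mathcal X\subset\mathbb R^d$ and $\mathcal Y\subset\mathbb R^{d'}$ be nonempty compact convex sets, $\mathbb P$ a probability measure on a sample space $\mathcal Z$, and $f:\mathcal X\times\mathcal Y\times\mathcal Z\to\mathbb R$ such that for every $z$ the function $f(\cdot,\cdot;z)$ is differentiable on $\mathcal X\times\mathcal Y$ with gradient $(\nabla_x f,\nabla_y f)$, this gradient is $\beta$-Lipschitz on $\mathcal X\times\mathcal Y$ (Euclidean norms, $\beta>0$), and $f(x,\cdot;z)$ is $\mu_y$-strongly concave on $\mathcal Y$ for all $x\in\mathcal X$, $z\in\mathcal Z$ ($\mu_y>0$), that is, $f(x,y_1;z)-f(x,y_2;z)\le\langle\nabla_y f(x,y_2;z),y_1-y_2\rangle-\frac{\mu_y}{2}\|y_1-y_2\|^2$ for all $y_1,y_2\in\mathcal Y$. Let $f(x,y;\cdot)$ and its gradients be measurable and $f(x,y;\cdot)$ be $\mathbb P$-integrable. Put $F(x,y)=\mathbb E_{z\sim\mathbb P}f(x,y;z)$ and $\Phi(x)=\max_{y\in\mathcal Y}F(x,y)$; for a sample $S=(z_1,\dots,z_n)$ of $n$ independent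 draws from $\mathbb P$ put $F_S(x,y)=\frac1n\sum_{i=1}^n f(x,y;z_i)$ and $\Phi_S(x)=\max_{y\in\mathcal Y}F_S(x,y)$. A solution of $\min_{x\in\mathcal X}\max_{y\in\mathcal Y}G(x,y)$ is a pair $(\bar x,\bar y)\in\mathcal X\times\mathcal Y$ such that $\bar y$ maximizes $G(\bar x,\cdot)$ over $\mathcal Y$ and $\bar x$ minimizes $x\mapsto\max_{y\in\mathcal Y}G(x,y)$ over $\mathcal X$. Let $(x^*,y^*)$ be a solution of the population problem ($G=F$), let $\mathcal X\subset\{x:\|x-x^*\|\le R_1\}$, and assume the Bernstein condition at $(x^*,y^*)$: there are $B_{x^*},B_{y^*}>0$ such that for all integers $k\ge2$ $$\mathbb E\|\nabla_x f(x^*,y^*;z)\|^k\le\tfrac{k!}{2}\,\mathbb E\|\nabla_x f(x^*,y^*;z)\|^2\,B_{x^*}^{k-2}<\infty,\qquad \mathbb E\|\nabla_y f(x^*,y^*;z)\|^k\le\tfrac{k!}{2}\,\mathbb E\|\nabla_y f(x^*,y^*;z)\|^2\,B_{y^*}^{k-2}<\infty .$$ **Theorem.** There is a constant $C>0$ that depends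 only on $\beta$, $\mu_y$, $R_1$, $B_{x^*}$, $B_{y^*}$ and on upper bounds for $\mathbb E\|\nabla_x f(x^*,y^*;z)\|^2$ and $\mathbb E\|\nabla_y f(x^*,y^*;z)\|^2$ (not on $n$, $\delta$, $d$, $d'$) such that for all $n\ge2$ and $\delta\in(0,1)$, with probability at least $1-\delta$ over $S$: for every empirical saddle point, i.e. every solution $(\hat x^*,\hat y^*)$ of the empirical problem ($G=F_S$), with $\hat x^*$ in the interior of $\mathcal X$, the function $\Phi$ is differentiable at $\hat x^*$ and $$\|\nabla\Phi(\hat x^*)\|\le C\sqrt{\frac{d+\log\frac{\log n}{\delta}}{n}} .$$ -/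

import Mathlib

open MeasureTheory

noncomputable section

/-- The gradient inequality defining `μ`-strong convexity on `W` of a function `g` with gradient
field `g'`. -/
def StronglyConvexGrad {E : Type*} [NormedAddCommGroup E] [InnerProductSpace ℝ E]
    (W : Set E) (g : E → ℝ) (g' : E → E) (μ : ℝ) : Prop :=
  ∀ w₁ ∈ W, ∀ w₂ ∈ W, g w₁ - g w₂ ≥ inner ℝ (g' w₂) (w₁ - w₂) + μ / 2 * ‖w₁ - w₂‖ ^ 2

/-- `g` is `μ`-strongly concave if `-g` is `μ`-strongly convex. -/
def StronglyConcaveGrad {E : Type*} [NormedAddCommGroup E] [InnerProductSpace ℝ E]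
    (W : Set E) (g : E → ℝ) (g' : E → E) (μ : ℝ) : Prop :=
  StronglyConvexGrad W (fun w => -g w) (fun w => -g' w) μ

/-- On `X × Y`, the function `h` of two vector variables is differentiable (relative to `X × Y`, so
that values of `h` outside of `X × Y` are irrelevant) with gradient `(hx, hy)`:
the derivative at `(x, y)` is `(u, v) ↦ ⟪hx x y, u⟫ + ⟪hy x y, v⟫`. -/
def HasPartialGradientsOn {E E' : Type*}
    [NormedAddCommGroup E] [InnerProductSpace ℝ E]
    [NormedAddCommGroup E'] [InnerProductSpace ℝ E']
    (X : Set E) (Y : Set E') (h : E → E' → ℝ) (hx : E → E' → E) (hy : E → E' → E') : Prop :=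
  ∀ x ∈ X, ∀ y ∈ Y,
    HasFDerivWithinAt (fun p : E × E' => h p.1 p.2)
      ((innerSL ℝ (hx x y)).comp (ContinuousLinearMap.fst ℝ E E')
        + (innerSL ℝ (hy x y)).comp (ContinuousLinearMap.snd ℝ E E'))
      (X ×ˢ Y) (x, y)

/-- `β`-Lipschitz continuity of the gradient `(hx, hy)` on `X × Y`, for the Euclidean norm of the
product. -/
def GradientLipschitzOn {E E' : Type*}
    [NormedAddCommGroup E] [InnerProductSpace ℝ E]
    [NormedAddCommGroup E'] [InnerProductSpace ℝ E']
    (X : Set E) (Y : Set E') (hx : E → E' → E) (hy : E → E' → E') (β : ℝ) : Prop :=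
  ∀ x₁ ∈ X, ∀ x₂ ∈ X, ∀ y₁ ∈ Y, ∀ y₂ ∈ Y,
    √(‖hx x₁ y₁ - hx x₂ y₂‖ ^ 2 + ‖hy x₁ y₁ - hy x₂ y₂‖ ^ 2)
      ≤ β * √(‖x₁ - x₂‖ ^ 2 + ‖y₁ - y₂‖ ^ 2)

/-- The nonconvex-strongly-concave setting for a cost function `f x y z` with gradients
`fx = ∇ₓ f` and `fy = ∇_y f` on `X × Y`, together with measurability in `z` and the existence of the
population risk. -/
structure IsNCSC {E E' Z : Type*}
    [NormedAddCommGroup E] [InnerProductSpace ℝ E] [MeasurableSpace E]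
    [NormedAddCommGroup E'] [InnerProductSpace ℝ E'] [MeasurableSpace E']
    [MeasurableSpace Z] (P : Measure Z) (X : Set E) (Y : Set E')
    (f : E → E' → Z → ℝ) (fx : E → E' → Z → E) (fy : E → E' → Z → E') (μ β : ℝ) : Prop where
  compact_X : IsCompact X
  convex_X : Convex ℝ X
  compact_Y : IsCompact Y
  convex_Y : Convex ℝ Y
  hasGradients : ∀ z, HasPartialGradientsOn X Y (fun x y => f x y z)
    (fun x y => fx x y z) (fun x y => fy x y z)
  smooth : ∀ z, GradientLipschitzOn X Y (fun x y => fx x y z) (fun x y => fy x y z) β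
  stronglyConcave : ∀ z, ∀ x ∈ X,
    StronglyConcaveGrad Y (fun y => f x y z) (fun y => fy x y z) μ
  measurable_fx : ∀ x ∈ X, ∀ y ∈ Y, Measurable (fx x y)
  measurable_fy : ∀ x ∈ X, ∀ y ∈ Y, Measurable (fy x y)
  measurable_f : ∀ x ∈ X, ∀ y ∈ Y, Measurable (f x y)
  integrable_f : ∀ x ∈ X, ∀ y ∈ Y, Integrable (f x y) P

/-- The population risk `F(x, y) = 𝔼 f(x, y; z)`. -/
def popRisk {E E' Z : Type*} [MeasurableSpace Z] (P : Measure Z)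
    (f : E → E' → Z → ℝ) (x : E) (y : E') : ℝ :=
  ∫ z, f x y z ∂P

/-- The empirical risk `F_S(x, y) = (1/n) ∑ᵢ f(x, y; zᵢ)` of a sample `S = (z₁, …, zₙ)`. -/
def empRisk {E E' Z : Type*} {n : ℕ} (S : Fin n → Z)
    (f : E → E' → Z → ℝ) (x : E) (y : E') : ℝ :=
  (1 / (n : ℝ)) * ∑ i, f x y (S i)

/-- The primal function `x ↦ max_{y ∈ Y} G(x, y)`. -/
def primal {E E' : Type*} (Y : Set E') (G : E → E' → ℝ) (x : E) : ℝ :=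
  sSup (G x '' Y)

/-- `(x, y)` solves `min_{x ∈ X} max_{y ∈ Y} G(x, y)`: `y` is a maximizer of `G(x, ·)` on `Y`, and
`x` is a minimizer on `X` of the primal function. Saddle points of `G` are such solutions. -/
def IsMinimaxSolution {E E' : Type*} (X : Set E) (Y : Set E') (G : E → E' → ℝ)
    (x : E) (y : E') : Prop :=
  x ∈ X ∧ y ∈ Y ∧ IsMaxOn (G x) Y y ∧ IsMinOn (primal Y G) X x

/-- The Bernstein condition with parameter `B > 0` for a random vector `g(z)`, `z ∼ P`: all absolute
moments of order `k ≥ 2` are finite, and `𝔼‖g‖ᵏ ≤ (k!/2) 𝔼‖g‖² Bᵏ⁻²`. -/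
def BernsteinCondition {E Z : Type*} [NormedAddCommGroup E] [MeasurableSpace Z]
    (P : Measure Z) (g : Z → E) (B : ℝ) : Prop :=
  0 < B ∧ ∀ k : ℕ, 2 ≤ k →
    Integrable (fun z => ‖g z‖ ^ k) P ∧
    ∫ z, ‖g z‖ ^ k ∂P ≤ (k.factorial : ℝ) / 2 * (∫ z, ‖g z‖ ^ 2 ∂P) * B ^ (k - 2)

end

/-! Let `m x` be the maximizer of `F(x, ·)`. Strong concavity makes `m` Lipschitz with constant `β /
μ`, and Danskin's theorem gives `∇Φ(x) = ∇ₓF(x, m x)` in the interior. At an interior empirical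
solution `(x̂, ŷ)`, Danskin's theorem for `F_S` and Fermat's rule give `∇ₓF_S(x̂, ŷ) = 0`. Strong
monotonicity bounds `μ ‖ŷ - m x̂‖` by the error of `∇_y F_S` at `(x̂, m x̂)`. Hence `‖∇Φ(x̂)‖` is at
most the error of `∇ₓF_S` at `(x̂, m x̂)` plus `β / μ` times that of `∇_y F_S`
(`norm_gradient_primal_le`).

It remains to control these errors uniformly along the graph of `m`, which is parametrized by `x`
alone. The nets therefore live in dimension `d`, and since the concentration inequality for vectors
is dimension-free (Pinelis' `cosh` argument), `d'` never enters. Chaining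
(`exists_uniform_deviation`) starts at `x*`, where `m x* = y*` and the Bernstein condition is
available; every increment is bounded, so a Hoeffding bound handles it.

The resulting rate is `√(q / n)` with `q = d + log (1 / δ)`. The iterated logarithm of the statement
is not needed; comparison with it costs a factor 2. If `q > n`, the rate exceeds 1 and boundedness
of the gradient suffices. -/

/-! ### Dimension-free concentration in Hilbert space -/

/-- The power series of `cosh r` is a series in `r ^ 2` with nonnegative coefficients, so `cosh` is
a convex function of the square of its argument; convexity is used term by term. -/
lemma Real.cosh_convex_comb_sq {w₁ w₂ p q r : ℝ} (h₁ : 0 ≤ w₁) (h₂ : 0 ≤ w₂) (hw : w₁ + w₂ = 1)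
    (hr : r ^ 2 = w₁ * p ^ 2 + w₂ * q ^ 2) :
    Real.cosh r ≤ w₁ * Real.cosh p + w₂ * Real.cosh q := by
  have hs := ((Real.hasSum_cosh p).mul_left w₁).add ((Real.hasSum_cosh q).mul_left w₂)
  refine hasSum_le (fun n => ?_) (Real.hasSum_cosh r) hs
  have hc := (convexOn_pow (𝕜 := ℝ) n).2 (x := p ^ 2) (sq_nonneg p) (y := q ^ 2) (sq_nonneg q)
    h₁ h₂ hw
  simp only [smul_eq_mul] at hc
  rw [← hr, ← pow_mul, ← pow_mul, ← pow_mul] at hc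
  calc r ^ (2 * n) / ((2 * n).factorial : ℝ)
      ≤ (w₁ * p ^ (2 * n) + w₂ * q ^ (2 * n)) / ((2 * n).factorial : ℝ) := by gcongr
    _ = _ := by ring

lemma integrable_norm_of_integrable_exp_norm {H Z : Type*} [NormedAddCommGroup H]
    [MeasurableSpace H] [OpensMeasurableSpace H] [MeasurableSpace Z] {P : Measure Z}
    {ξ : Z → H} (hm : Measurable ξ)
    (he : Integrable (fun z => Real.exp ‖ξ z‖) P) : Integrable (fun z => ‖ξ z‖) P :=
  he.mono' hm.norm.aestronglyMeasurable (Filter.Eventually.of_forall fun z => by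
    rw [norm_norm]; linarith [Real.add_one_le_exp ‖ξ z‖])

section Pinelis

variable {H : Type*} [NormedAddCommGroup H] [InnerProductSpace ℝ H]

/-- With `c` the cosine of the angle between `s` and `x`, `‖s + x‖ ^ 2` is the convex combination of
`(‖s‖ + ‖x‖) ^ 2` and `(‖s‖ - ‖x‖) ^ 2` with weights `(1 ± c) / 2`. -/
lemma cosh_norm_add_le (s x : H) (hs : s ≠ 0) (hx : x ≠ 0) :
    Real.cosh ‖s + x‖ ≤ Real.cosh ‖s‖ * Real.cosh ‖x‖
      + inner ℝ s x / (‖s‖ * ‖x‖) * (Real.sinh ‖s‖ * Real.sinh ‖x‖) := by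
  have ha : 0 < ‖s‖ := norm_pos_iff.2 hs
  have hb : 0 < ‖x‖ := norm_pos_iff.2 hx
  set a := ‖s‖
  set b := ‖x‖
  set c := inner ℝ s x / (a * b) with hc
  have hcs := abs_le.1 (abs_real_inner_div_norm_mul_norm_le_one s x)
  have hin : inner ℝ s x = c * (a * b) := by rw [hc]; field_simp
  have hr : ‖s + x‖ ^ 2 = (1 + c) / 2 * (a + b) ^ 2 + (1 - c) / 2 * (a - b) ^ 2 := by
    rw [norm_add_sq_real, hin]; ring
  have h := Real.cosh_convex_comb_sq (by linarith [hcs.1]) (by linarith [hcs.2]) (by ring) hr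
  rw [Real.cosh_add, Real.cosh_sub] at h
  linarith

/-- Isolates a term linear in `x`, which has mean zero for centered `x`. What is left of the `sinh`
product is `c * sinh ‖s‖ * (sinh ‖x‖ - ‖x‖)`, at most `cosh ‖s‖ * (sinh ‖x‖ - ‖x‖)`. -/
lemma cosh_norm_add_le_linear (s x : H) :
    Real.cosh ‖s + x‖ ≤ Real.cosh ‖s‖ * (Real.exp ‖x‖ - ‖x‖)
      + Real.sinh ‖s‖ / ‖s‖ * inner ℝ s x := by
  have hexp : Real.exp ‖x‖ = Real.cosh ‖x‖ + Real.sinh ‖x‖ := (Real.cosh_add_sinh _).symm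
  have hsb : ‖x‖ ≤ Real.sinh ‖x‖ := Real.self_le_sinh_iff.2 (norm_nonneg x)
  have hca : 0 < Real.cosh ‖s‖ := Real.cosh_pos _
  rcases eq_or_ne s 0 with rfl | hs
  · simp; linarith
  rcases eq_or_ne x 0 with rfl | hx
  · simp
  have ha : 0 < ‖s‖ := norm_pos_iff.2 hs
  have hb : 0 < ‖x‖ := norm_pos_iff.2 hx
  have h := cosh_norm_add_le s x hs hx
  have hi : inner ℝ s x ≤ ‖s‖ * ‖x‖ := real_inner_le_norm s x
  have hsa : 0 ≤ Real.sinh ‖s‖ := Real.sinh_nonneg_iff.2 ha.le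
  have hle : Real.sinh ‖s‖ ≤ Real.cosh ‖s‖ := (Real.sinh_lt_cosh _).le
  have e : inner ℝ s x / (‖s‖ * ‖x‖) * (Real.sinh ‖s‖ * Real.sinh ‖x‖)
      - Real.sinh ‖s‖ / ‖s‖ * inner ℝ s x
      = inner ℝ s x / (‖s‖ * ‖x‖) * (Real.sinh ‖s‖ * (Real.sinh ‖x‖ - ‖x‖)) := by
    field_simp
  have h1 : inner ℝ s x / (‖s‖ * ‖x‖) ≤ 1 := (div_le_one (by positivity)).2 hi
  have h2 : inner ℝ s x / (‖s‖ * ‖x‖) * (Real.sinh ‖s‖ * (Real.sinh ‖x‖ - ‖x‖))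
      ≤ 1 * (Real.cosh ‖s‖ * (Real.sinh ‖x‖ - ‖x‖)) := by
    have h3 : 0 ≤ Real.sinh ‖x‖ - ‖x‖ := by linarith
    have h4 : 0 ≤ Real.sinh ‖s‖ * (Real.sinh ‖x‖ - ‖x‖) := by positivity
    have h5 : Real.sinh ‖s‖ * (Real.sinh ‖x‖ - ‖x‖) ≤ Real.cosh ‖s‖ * (Real.sinh ‖x‖ - ‖x‖) := by
      gcongr
    nlinarith
  rw [hexp]
  nlinarith

variable [CompleteSpace H] [MeasurableSpace H] [BorelSpace H] [SecondCountableTopology H]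
  {Z : Type*} [MeasurableSpace Z] {P : Measure Z}

lemma lintegral_cosh_norm_add_le {ξ : Z → H} (hm : Measurable ξ)
    (he : Integrable (fun z => Real.exp ‖ξ z‖) P) (h0 : ∫ z, ξ z ∂P = 0) (s : H) :
    ∫⁻ z, ENNReal.ofReal (Real.cosh ‖ξ z + s‖) ∂P
      ≤ ENNReal.ofReal (Real.cosh ‖s‖) * ENNReal.ofReal (∫ z, (Real.exp ‖ξ z‖ - ‖ξ z‖) ∂P) := by
  have hn := integrable_norm_of_integrable_exp_norm hm he
  have hξ : Integrable ξ P := (integrable_norm_iff hm.aestronglyMeasurable).1 hn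
  have hen : Integrable (fun z => Real.exp ‖ξ z‖ - ‖ξ z‖) P := he.sub hn
  have hi : Integrable (fun z => inner ℝ s (ξ z)) P := hξ.const_inner s
  have hg : Integrable (fun z => Real.cosh ‖s‖ * (Real.exp ‖ξ z‖ - ‖ξ z‖)
      + Real.sinh ‖s‖ / ‖s‖ * inner ℝ s (ξ z)) P :=
    (hen.const_mul _).add (hi.const_mul _)
  have hb : ∀ z, Real.cosh ‖ξ z + s‖ ≤ Real.cosh ‖s‖ * (Real.exp ‖ξ z‖ - ‖ξ z‖)
      + Real.sinh ‖s‖ / ‖s‖ * inner ℝ s (ξ z) := fun z => by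
    rw [add_comm]; exact cosh_norm_add_le_linear s (ξ z)
  calc ∫⁻ z, ENNReal.ofReal (Real.cosh ‖ξ z + s‖) ∂P
      ≤ ∫⁻ z, ENNReal.ofReal (Real.cosh ‖s‖ * (Real.exp ‖ξ z‖ - ‖ξ z‖)
      + Real.sinh ‖s‖ / ‖s‖ * inner ℝ s (ξ z)) ∂P :=
        lintegral_mono fun z => ENNReal.ofReal_le_ofReal (hb z)
    _ = ENNReal.ofReal (∫ z, (Real.cosh ‖s‖ * (Real.exp ‖ξ z‖ - ‖ξ z‖)
      + Real.sinh ‖s‖ / ‖s‖ * inner ℝ s (ξ z)) ∂P) := by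
        rw [ofReal_integral_eq_lintegral_ofReal hg]
        exact Filter.Eventually.of_forall fun z => (Real.cosh_pos _).le.trans (hb z)
    _ = _ := by
        rw [integral_add (hen.const_mul _) (hi.const_mul _), integral_const_mul,
          integral_const_mul, integral_inner hξ, h0, inner_zero_right, mul_zero, add_zero,
          ENNReal.ofReal_mul (Real.cosh_pos _).le]

variable [IsProbabilityMeasure P]

/-- Integrating out one draw with the others fixed costs one factor, because the linear term of
`cosh_norm_add_le_linear` vanishes in the mean. With `lintegral`, integrability of the `cosh` of the
sum need not be checked. -/
lemma lintegral_cosh_norm_sum_le {ξ : Z → H} (hm : Measurable ξ)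
    (he : Integrable (fun z => Real.exp ‖ξ z‖) P) (h0 : ∫ z, ξ z ∂P = 0) (n : ℕ) :
    ∫⁻ S, ENNReal.ofReal (Real.cosh ‖∑ i, ξ (S i)‖) ∂(Measure.pi (fun _ : Fin n => P))
      ≤ ENNReal.ofReal (∫ z, (Real.exp ‖ξ z‖ - ‖ξ z‖) ∂P) ^ n := by
  induction n with
  | zero => simp
  | succ n ih =>
    have hmp := (measurePreserving_piFinSuccAbove (fun _ : Fin (n + 1) => P) 0).symm
    rw [← hmp.lintegral_comp_emb (MeasurableEquiv.measurableEmbedding _)]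
    have hmeas : Measurable fun p : Z × (Fin n → Z) =>
        ENNReal.ofReal (Real.cosh ‖ξ p.1 + ∑ i, ξ (p.2 i)‖) := by
      have : Measurable fun p : Z × (Fin n → Z) => ξ p.1 + ∑ i, ξ (p.2 i) := by fun_prop
      exact (Real.measurable_cosh.comp this.norm).ennreal_ofReal
    have e : ∀ p : Z × (Fin n → Z),
        ENNReal.ofReal (Real.cosh ‖∑ i, ξ ((MeasurableEquiv.piFinSuccAbove
          (fun _ : Fin (n + 1) => Z) 0).symm p i)‖)
        = ENNReal.ofReal (Real.cosh ‖ξ p.1 + ∑ i, ξ (p.2 i)‖) := by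
      intro p
      rw [Fin.sum_univ_succ]
      rfl
    simp_rw [e]
    have := lintegral_prod_symm' (μ := P) (ν := Measure.pi fun _ : Fin n => P) _ hmeas
    refine this.le.trans ?_
    calc _ ≤ ∫⁻ S, ENNReal.ofReal (Real.cosh ‖∑ i, ξ (S i)‖) *
          ENNReal.ofReal (∫ z, (Real.exp ‖ξ z‖ - ‖ξ z‖) ∂P) ∂(Measure.pi fun _ : Fin n => P) :=
          lintegral_mono fun S => lintegral_cosh_norm_add_le hm he h0 _
      _ ≤ _ := by
          rw [lintegral_mul_const', pow_succ]
          · gcongr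
          · exact ENNReal.ofReal_ne_top

/-- A dimension-free exponential tail bound for sums of independent centered random vectors. -/
lemma measure_le_norm_sum_le {ξ : Z → H} (hm : Measurable ξ) (h0 : ∫ z, ξ z ∂P = 0) {l K : ℝ}
    (hl : 0 < l) (he : Integrable (fun z => Real.exp (l * ‖ξ z‖)) P)
    (hK : ∫ z, (Real.exp (l * ‖ξ z‖) - l * ‖ξ z‖) ∂P ≤ Real.exp (l ^ 2 * K)) (n : ℕ) (t : ℝ) :
    Measure.pi (fun _ : Fin n => P) {S | t < ‖∑ i, ξ (S i)‖}
      ≤ ENNReal.ofReal (2 * Real.exp (n * (l ^ 2 * K) - l * t)) := by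
  have hnorm : ∀ x : H, ‖l • x‖ = l * ‖x‖ := fun x => by
    rw [norm_smul, Real.norm_of_nonneg hl.le]
  have h1 := lintegral_cosh_norm_sum_le (P := P) (ξ := fun z => l • ξ z) (hm.const_smul l)
    (by simpa only [hnorm] using he) (by rw [integral_smul, h0, smul_zero]) n
  simp only [hnorm, ← Finset.smul_sum] at h1
  have hmeas : Measurable fun S : Fin n → Z =>
      ENNReal.ofReal (Real.cosh (l * ‖∑ i, ξ (S i)‖)) := by
    have : Measurable fun S : Fin n → Z => ∑ i, ξ (S i) := by fun_prop
    exact (Real.measurable_cosh.comp (this.norm.const_mul l)).ennreal_ofReal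
  -- Markov's inequality; the threshold comes from `cosh u ≥ exp u / 2`.
  have h2 := meas_ge_le_lintegral_div (μ := Measure.pi fun _ : Fin n => P) hmeas.aemeasurable
    (ε := ENNReal.ofReal (Real.exp (l * t) / 2)) (by simp; positivity) ENNReal.ofReal_ne_top
  refine (measure_mono fun S hS => ?_).trans (h2.trans ?_)
  · simp only [Set.mem_ofPred_eq] at hS ⊢
    apply ENNReal.ofReal_le_ofReal
    rw [Real.cosh_eq]
    have : Real.exp (l * t) ≤ Real.exp (l * ‖∑ i, ξ (S i)‖) := by gcongr
    linarith [Real.exp_pos (-(l * ‖∑ i, ξ (S i)‖))]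
  · refine ENNReal.div_le_of_le_mul (h1.trans ?_)
    rw [← ENNReal.ofReal_mul (by positivity)]
    calc _ ≤ ENNReal.ofReal (Real.exp (l ^ 2 * K)) ^ n := by gcongr
      _ = ENNReal.ofReal (Real.exp (n * (l ^ 2 * K))) := by
        rw [← ENNReal.ofReal_pow (Real.exp_pos _).le, ← Real.exp_nat_mul]
      _ = _ := by
        congr 1
        rw [sub_eq_add_neg, Real.exp_add, Real.exp_neg]
        field_simp

lemma Real.exp_sub_self_le_exp_sq {x : ℝ} (hx : 0 ≤ x) : Real.exp x - x ≤ Real.exp (x ^ 2) := by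
  rcases le_total x 1 with h | h
  · have := (abs_le.1 (Real.abs_exp_sub_one_sub_id_le (x := x) (by rwa [abs_of_nonneg hx]))).2
    linarith [Real.add_one_le_exp (x ^ 2)]
  · have : Real.exp x ≤ Real.exp (x ^ 2) := by gcongr; nlinarith
    linarith

/-- Vector-valued Hoeffding inequality. -/
lemma measure_le_norm_sum_le_of_bounded {ξ : Z → H} (hm : Measurable ξ) (h0 : ∫ z, ξ z ∂P = 0)
    {b : ℝ} (hb : 0 < b) (hξ : ∀ z, ‖ξ z‖ ≤ b) {n : ℕ} (hn : 0 < n) {T : ℝ} (hT : 0 < T) :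
    Measure.pi (fun _ : Fin n => P) {S | n * (2 * b * T / √n) < ‖∑ i, ξ (S i)‖}
      ≤ ENNReal.ofReal (2 * Real.exp (- T ^ 2)) := by
  have hn' : (0 : ℝ) < n := by exact_mod_cast hn
  have hsn : 0 < √(n : ℝ) := Real.sqrt_pos.2 hn'
  have hsq : √(n : ℝ) ^ 2 = n := Real.sq_sqrt hn'.le
  -- Minimizer over `l` of the exponent `n * l ^ 2 * b ^ 2 - l * t` at `t = 2 * b * T * √n`; the
  -- minimum is `-T ^ 2`.
  set l := T / (b * √n) with hl
  have hlpos : 0 < l := by positivity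
  have hbd : ∀ z, l * ‖ξ z‖ ≤ l * b := fun z => by gcongr; exact hξ z
  have he : Integrable (fun z => Real.exp (l * ‖ξ z‖)) P := by
    refine Integrable.of_bound (C := Real.exp (l * b))
      (Real.measurable_exp.comp (hm.norm.const_mul l)).aestronglyMeasurable
      (Filter.Eventually.of_forall fun z => ?_)
    rw [Real.norm_of_nonneg (Real.exp_pos _).le]
    exact Real.exp_le_exp.2 (hbd z)
  have hK : ∫ z, (Real.exp (l * ‖ξ z‖) - l * ‖ξ z‖) ∂P ≤ Real.exp (l ^ 2 * b ^ 2) := by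
    have : ∫ z, (Real.exp (l * ‖ξ z‖) - l * ‖ξ z‖) ∂P ≤ ∫ _z, Real.exp (l ^ 2 * b ^ 2) ∂P := by
      refine integral_mono_of_nonneg (Filter.Eventually.of_forall fun z => ?_)
        (integrable_const _) (Filter.Eventually.of_forall fun z => ?_)
      · simp only [Pi.zero_apply]; linarith [Real.add_one_le_exp (l * ‖ξ z‖)]
      · refine (Real.exp_sub_self_le_exp_sq (by positivity)).trans (Real.exp_le_exp.2 ?_)
        rw [← mul_pow]
        exact pow_le_pow_left₀ (by positivity) (hbd z) 2
    simpa using this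
  refine (measure_le_norm_sum_le hm h0 hlpos he hK n _).trans (ENNReal.ofReal_le_ofReal ?_)
  have : (n : ℝ) * (l ^ 2 * b ^ 2) - l * (n * (2 * b * T / √n)) = - T ^ 2 := by
    rw [hl, ← hsq]; field_simp; rw [Real.sqrt_sq hsn.le]; ring
  rw [this]

end Pinelis

/-! ### Exponential moments under the Bernstein condition -/

lemma Real.exp_sub_self_le {x : ℝ} (hx : 0 ≤ x) : Real.exp x - x ≤ 1 + x ^ 2 * Real.exp x := by
  have h := Real.add_one_le_exp (-x)
  have h1 : Real.exp x - 1 ≤ x * Real.exp x := by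
    have : Real.exp (-x) * Real.exp x = 1 := by rw [← Real.exp_add]; simp
    nlinarith [Real.exp_pos x]
  nlinarith

/-- A bound for the exponential moment `𝔼 exp(‖g‖ / (2 B))` under the Bernstein condition. -/
noncomputable def bernsteinExpMoment (V B : ℝ) : ℝ := 2 * (1 + (1 + V) / B + V / (2 * B ^ 2))

/-- A bound for the variance proxy of the centered vector under the Bernstein condition. -/
noncomputable def bernsteinProxy (V B : ℝ) : ℝ :=
  2 * (4 * B) ^ 2 * Real.exp ((1 + V) / (2 * B)) * bernsteinExpMoment V B

/-- The factor of the deviation inequality under the Bernstein condition. -/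
noncomputable def bernsteinFactor (V B : ℝ) : ℝ := bernsteinProxy V B / (4 * B) + 12 * B

lemma norm_le_one_add_sq {H : Type*} [NormedAddCommGroup H] (x : H) : ‖x‖ ≤ 1 + ‖x‖ ^ 2 := by
  nlinarith [sq_nonneg (‖x‖ - 1), norm_nonneg x]

section Bernstein

variable {H : Type*} [NormedAddCommGroup H] [MeasurableSpace H] [BorelSpace H]
  {Z : Type*} [MeasurableSpace Z] {P : Measure Z} [IsProbabilityMeasure P]

lemma BernsteinCondition.integrable_norm {g : Z → H} (hm : Measurable g) {B : ℝ}
    (h : BernsteinCondition P g B) : Integrable (fun z => ‖g z‖) P :=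
  ((integrable_const 1).add (h.2 2 le_rfl).1).mono' hm.norm.aestronglyMeasurable
    (Filter.Eventually.of_forall fun z => by rw [norm_norm]; exact norm_le_one_add_sq (g z))

lemma BernsteinCondition.integral_norm_le {g : Z → H} (hm : Measurable g) {B V : ℝ}
    (h : BernsteinCondition P g B) (hV : ∫ z, ‖g z‖ ^ 2 ∂P ≤ V) : ∫ z, ‖g z‖ ∂P ≤ 1 + V := by
  have : ∫ z, ‖g z‖ ∂P ≤ ∫ z, (1 + ‖g z‖ ^ 2) ∂P :=
    integral_mono (h.integrable_norm hm) ((integrable_const 1).add (h.2 2 le_rfl).1)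
      fun z => norm_le_one_add_sq (g z)
  rw [integral_add (integrable_const 1) (h.2 2 le_rfl).1] at this
  simp at this
  linarith

/-- Exponential series, integrated term by term. The factorial in the Bernstein condition cancels
that of the series, so the terms with `k ≥ 2` are at most `V / (2 * B ^ 2) * 2 ^ (-k)`. The constant
`A` also covers `k = 0` and, through `𝔼‖g‖ ≤ 1 + V`, `k = 1`; the geometric series contributes the
factor 2. -/
lemma BernsteinCondition.lintegral_exp_le {g : Z → H} (hm : Measurable g) {B V : ℝ}
    (h : BernsteinCondition P g B) (hV : ∫ z, ‖g z‖ ^ 2 ∂P ≤ V) :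
    ∫⁻ z, ENNReal.ofReal (Real.exp (‖g z‖ / (2 * B))) ∂P
      ≤ ENNReal.ofReal (bernsteinExpMoment V B) := by
  have hB := h.1
  have hV0 : 0 ≤ V := (integral_nonneg fun z => by positivity).trans hV
  set A := 1 + (1 + V) / B + V / (2 * B ^ 2) with hA
  have hA0 : 0 ≤ A := by positivity
  have hexp : ∀ z, ENNReal.ofReal (Real.exp (‖g z‖ / (2 * B)))
      = ∑' k : ℕ, ENNReal.ofReal ((‖g z‖ / (2 * B)) ^ k / k.factorial) := fun z => by
    have hs := NormedSpace.expSeries_div_hasSum_exp (𝔸 := ℝ) (‖g z‖ / (2 * B))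
    rw [← Real.exp_eq_exp_ℝ] at hs
    rw [← ENNReal.ofReal_tsum_of_nonneg (fun k => by positivity) hs.summable, hs.tsum_eq]
  have hint : ∀ k : ℕ, Integrable (fun z => ‖g z‖ ^ k) P := fun k => by
    rcases k with _ | _ | k
    · simp
    · simpa using h.integrable_norm hm
    · exact (h.2 _ (by omega)).1
  have hterm : ∀ k : ℕ, ∫⁻ z, ENNReal.ofReal ((‖g z‖ / (2 * B)) ^ k / k.factorial) ∂P
      ≤ ENNReal.ofReal (A * (1 / 2) ^ k) := fun k => by
    have e : ∀ z, (‖g z‖ / (2 * B)) ^ k / k.factorial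
        = ((2 * B) ^ k * k.factorial)⁻¹ * ‖g z‖ ^ k := fun z => by
      rw [div_pow]; field_simp
    simp_rw [e]
    rw [← ofReal_integral_eq_lintegral_ofReal ((hint k).const_mul _)
      (Filter.Eventually.of_forall fun z => by positivity), integral_const_mul]
    apply ENNReal.ofReal_le_ofReal
    rcases k with _ | _ | k
    · have h4 : 0 ≤ V / (2 * B ^ 2) := by positivity
      have h5 : 0 ≤ (1 + V) / B := by positivity
      simp only [pow_zero, Nat.factorial_zero, Nat.cast_one, mul_one, inv_one, integral_const,
        probReal_univ, smul_eq_mul]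
      linarith
    · have h1 := h.integral_norm_le hm hV
      simp only [zero_add, pow_one, Nat.factorial_one, Nat.cast_one, mul_one]
      have h2 : (2 * B)⁻¹ * ∫ z, ‖g z‖ ∂P ≤ (2 * B)⁻¹ * (1 + V) := by gcongr
      have h3 : (2 * B)⁻¹ * (1 + V) = (1 + V) / B * (1 / 2) := by field_simp
      have h4 : 0 ≤ V / (2 * B ^ 2) := by positivity
      nlinarith
    · have h1 := (h.2 (k + 2) (by omega)).2
      have h2 : ((2 * B) ^ (k + 2) * (k + 2).factorial : ℝ)⁻¹ * ∫ z, ‖g z‖ ^ (k + 2) ∂P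
          ≤ ((2 * B) ^ (k + 2) * (k + 2).factorial : ℝ)⁻¹ *
            (((k + 2).factorial : ℝ) / 2 * V * B ^ k) := by
        gcongr
        refine h1.trans ?_
        rw [Nat.add_sub_cancel]
        gcongr
      have h3 : ((2 * B) ^ (k + 2) * (k + 2).factorial : ℝ)⁻¹ *
            (((k + 2).factorial : ℝ) / 2 * V * B ^ k) = V / (2 * B ^ 2) * (1 / 2) ^ (k + 2) := by
        have : ((k + 2).factorial : ℝ) ≠ 0 := by positivity
        rw [mul_pow, one_div, inv_pow]; field_simp; ring
      have h5 : 0 ≤ (1 + V) / B := by positivity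
      have h6 : (0 : ℝ) ≤ (1 / 2) ^ (k + 2) := by positivity
      refine (h2.trans h3.le).trans ?_
      gcongr
      linarith
  simp_rw [hexp]
  rw [lintegral_tsum fun k => by
    exact (((hm.norm.div_const _).pow_const k).div_const _).ennreal_ofReal.aemeasurable]
  refine (ENNReal.tsum_le_tsum hterm).trans ?_
  rw [← ENNReal.ofReal_tsum_of_nonneg (fun k => by positivity)
    (summable_geometric_two.mul_left A), tsum_mul_left, tsum_geometric_two]
  unfold bernsteinExpMoment
  rw [mul_comm]

lemma BernsteinCondition.integrable_exp {g : Z → H} (hm : Measurable g) {B : ℝ}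
    (h : BernsteinCondition P g B) : Integrable (fun z => Real.exp (‖g z‖ / (2 * B))) P := by
  refine ⟨(Real.measurable_exp.comp (hm.norm.div_const _)).aestronglyMeasurable, ?_⟩
  rw [hasFiniteIntegral_iff_ofReal (Filter.Eventually.of_forall fun z => (Real.exp_pos _).le)]
  exact (h.lintegral_exp_le hm le_rfl).trans_lt ENNReal.ofReal_lt_top

lemma BernsteinCondition.integral_exp_le {g : Z → H} (hm : Measurable g) {B V : ℝ}
    (h : BernsteinCondition P g B) (hV : ∫ z, ‖g z‖ ^ 2 ∂P ≤ V) :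
    ∫ z, Real.exp (‖g z‖ / (2 * B)) ∂P ≤ bernsteinExpMoment V B := by
  have hB := h.1
  have hV0 : 0 ≤ V := (integral_nonneg fun z => by positivity).trans hV
  have := h.lintegral_exp_le hm hV
  rw [← ofReal_integral_eq_lintegral_ofReal (h.integrable_exp hm)
    (Filter.Eventually.of_forall fun z => (Real.exp_pos _).le)] at this
  refine (ENNReal.ofReal_le_ofReal_iff ?_).1 this
  unfold bernsteinExpMoment
  positivity

end Bernstein

/-! ### Deviations of empirical means -/

section Deviation

variable {H : Type*} [NormedAddCommGroup H] [InnerProductSpace ℝ H]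
  {Z : Type*} [MeasurableSpace Z]

/-- The deviation of the empirical mean of `g` from its expectation. -/
noncomputable def deviation (P : Measure Z) {n : ℕ} (S : Fin n → Z) (g : Z → H) : H :=
  (n : ℝ)⁻¹ • ∑ i, g (S i) - ∫ z, g z ∂P

variable {P : Measure Z}

lemma deviation_sub {n : ℕ} (S : Fin n → Z) {g g' : Z → H} (hg : Integrable g P)
    (hg' : Integrable g' P) :
    deviation P S (fun z => g z - g' z) = deviation P S g - deviation P S g' := by
  unfold deviation
  rw [integral_sub hg hg', Finset.sum_sub_distrib, smul_sub]
  abel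

lemma deviation_eq_sum {n : ℕ} (hn : 0 < n) (S : Fin n → Z) (g : Z → H) :
    deviation P S g = (n : ℝ)⁻¹ • ∑ i, (g (S i) - ∫ z, g z ∂P) := by
  have : (n : ℝ) ≠ 0 := by positivity
  unfold deviation
  rw [Finset.sum_sub_distrib, smul_sub, Finset.sum_const, Finset.card_univ, Fintype.card_fin,
    ← Nat.cast_smul_eq_nsmul ℝ, smul_smul, inv_mul_cancel₀ this, one_smul]

lemma lt_norm_sum_of_lt_norm_deviation {n : ℕ} (hn : 0 < n) {S : Fin n → Z} {g : Z → H} {r : ℝ}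
    (h : r < ‖deviation P S g‖) : n * r < ‖∑ i, (g (S i) - ∫ z, g z ∂P)‖ := by
  have hn' : (0 : ℝ) < n := by exact_mod_cast hn
  rw [deviation_eq_sum hn, norm_smul, norm_inv, Real.norm_of_nonneg hn'.le] at h
  rwa [← lt_inv_mul_iff₀ hn']

lemma norm_deviation_le {n : ℕ} (hn : 0 < n) (S : Fin n → Z) [IsProbabilityMeasure P]
    {g : Z → H} {b : ℝ} (hb : ∀ z, ‖g z‖ ≤ b) : ‖deviation P S g‖ ≤ 2 * b := by
  have hn' : (0 : ℝ) < n := by exact_mod_cast hn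
  have h1 : ‖∫ z, g z ∂P‖ ≤ b := by
    simpa using norm_integral_le_of_norm_le_const (μ := P) (Filter.Eventually.of_forall hb)
  have h2 : ‖(n : ℝ)⁻¹ • ∑ i, g (S i)‖ ≤ b := by
    rw [norm_smul, norm_inv, Real.norm_of_nonneg hn'.le, inv_mul_le_iff₀ hn']
    refine (norm_sum_le_of_le _ fun i _ => hb (S i)).trans ?_
    simp
  unfold deviation
  linarith [norm_sub_le ((n : ℝ)⁻¹ • ∑ i, g (S i)) (∫ z, g z ∂P)]

variable [MeasurableSpace H] [BorelSpace H] [SecondCountableTopology H]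

lemma measurable_deviation {n : ℕ} {g : Z → H} (hm : Measurable g) :
    Measurable fun S : Fin n → Z => deviation P S g := by
  unfold deviation
  fun_prop

variable [CompleteSpace H] [IsProbabilityMeasure P]

lemma measure_lt_norm_deviation_of_bounded {g : Z → H} (hm : Measurable g)
    {b : ℝ} (hb : 0 < b) (hg : ∀ z, ‖g z‖ ≤ b) {n : ℕ} (hn : 0 < n) {T : ℝ} (hT : 0 < T) :
    Measure.pi (fun _ : Fin n => P) {S | 4 * b * T / √n < ‖deviation P S g‖}
      ≤ ENNReal.ofReal (2 * Real.exp (- T ^ 2)) := by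
  have hi : Integrable g P := Integrable.of_bound hm.aestronglyMeasurable b
    (Filter.Eventually.of_forall hg)
  have h1 : ‖∫ z, g z ∂P‖ ≤ b := by
    simpa using norm_integral_le_of_norm_le_const (μ := P) (Filter.Eventually.of_forall hg)
  refine (measure_mono fun S hS => ?_).trans
    (measure_le_norm_sum_le_of_bounded (ξ := fun z => g z - ∫ z, g z ∂P) (b := 2 * b) (P := P)
      (hm.sub_const _) ?_ (by positivity)
      (fun z => by linarith [norm_sub_le (g z) (∫ z, g z ∂P), hg z]) hn hT)
  · have := lt_norm_sum_of_lt_norm_deviation hn hS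
    simp only [Set.mem_ofPred_eq]
    convert this using 2
    ring
  · rw [integral_sub hi (integrable_const _)]; simp

/-- Vector-valued Bernstein inequality in the sub-Gaussian range. -/
lemma BernsteinCondition.measure_lt_norm_deviation {g : Z → H} (hm : Measurable g) {B V : ℝ}
    (h : BernsteinCondition P g B) (hV : ∫ z, ‖g z‖ ^ 2 ∂P ≤ V) {n : ℕ} {T : ℝ} (hT : 0 < T)
    (hTn : T ≤ √n) :
    Measure.pi (fun _ : Fin n => P) {S | bernsteinFactor V B * T / √n < ‖deviation P S g‖}
      ≤ ENNReal.ofReal (2 * Real.exp (- (3 * T ^ 2))) := by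
  have hB := h.1
  have hV0 : 0 ≤ V := (integral_nonneg fun z => by positivity).trans hV
  have hsn : 0 < √(n : ℝ) := hT.trans_le hTn
  have hn' : (0 : ℝ) < n := Real.sqrt_pos.1 hsn
  have hn : 0 < n := by exact_mod_cast hn'
  have hsq : √(n : ℝ) ^ 2 = n := Real.sq_sqrt hn'.le
  have hi : Integrable g P :=
    (integrable_norm_iff hm.aestronglyMeasurable).1 (h.integrable_norm hm)
  set m := ∫ z, g z ∂P with hmdef
  have hmn : ‖m‖ ≤ 1 + V := (norm_integral_le_integral_norm _).trans (h.integral_norm_le hm hV)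
  have hnorm : ∀ z, ‖g z - m‖ ≤ ‖g z‖ + (1 + V) := fun z => by
    linarith [norm_sub_le (g z) m]
  -- Half of the exponent `1 / (2 * B)` whose moment is controlled: the other half absorbs a
  -- quadratic factor below. The hypothesis `T ≤ √n` is what keeps `l ≤ l₀`.
  set l₀ := 1 / (4 * B) with hl₀
  have hl₀pos : 0 < l₀ := by positivity
  set l := l₀ * (T / √n) with hl
  have hlpos : 0 < l := by positivity
  have hle : l ≤ l₀ := mul_le_of_le_one_right hl₀pos.le ((div_le_one hsn).2 hTn)
  have hexp2 : ∀ z, Real.exp (2 * l₀ * ‖g z - m‖)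
      ≤ Real.exp ((1 + V) / (2 * B)) * Real.exp (‖g z‖ / (2 * B)) := fun z => by
    rw [← Real.exp_add]
    apply Real.exp_le_exp.2
    have : 2 * l₀ * ‖g z - m‖ ≤ 2 * l₀ * (‖g z‖ + (1 + V)) := by gcongr; exact hnorm z
    refine this.trans_eq ?_
    rw [hl₀]; field_simp; ring
  have hmeas : Measurable fun z => ‖g z - m‖ := (hm.sub_const m).norm
  have hIdom : Integrable (fun z => Real.exp ((1 + V) / (2 * B)) * Real.exp (‖g z‖ / (2 * B))) P :=
    (h.integrable_exp hm).const_mul _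
  have he : Integrable (fun z => Real.exp (l * ‖g z - m‖)) P := by
    refine hIdom.mono' (Real.measurable_exp.comp (hmeas.const_mul l)).aestronglyMeasurable
      (Filter.Eventually.of_forall fun z => ?_)
    rw [Real.norm_of_nonneg (Real.exp_pos _).le]
    refine le_trans (Real.exp_le_exp.2 ?_) (hexp2 z)
    gcongr
    linarith
  -- Here `exp u - u ≤ 1 + u ^ 2 * exp u` at `u = l * ‖g z - m‖`. The square is a multiple of `(l₀ *
  -- ‖g z - m‖) ^ 2 / 2 ≤ exp (l₀ * ‖g z - m‖)`, and the two exponentials multiply to at most `exp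
  -- (2 * l₀ * ‖g z - m‖)`.
  have hpt : ∀ z, Real.exp (l * ‖g z - m‖) - l * ‖g z - m‖ ≤
      1 + l ^ 2 * (2 * (4 * B) ^ 2) *
        (Real.exp ((1 + V) / (2 * B)) * Real.exp (‖g z‖ / (2 * B))) := fun z => by
    refine (Real.exp_sub_self_le (by positivity)).trans ?_
    have h1 : (l₀ * ‖g z - m‖) ^ 2 / 2 ≤ Real.exp (l₀ * ‖g z - m‖) := by
      have := Real.quadratic_le_exp_of_nonneg (x := l₀ * ‖g z - m‖) (by positivity)
      have : 0 ≤ l₀ * ‖g z - m‖ := by positivity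
      linarith
    have h2 : Real.exp (l * ‖g z - m‖) ≤ Real.exp (l₀ * ‖g z - m‖) := by gcongr
    have h3 : (l * ‖g z - m‖) ^ 2
        = l ^ 2 * (2 * (4 * B) ^ 2) * ((l₀ * ‖g z - m‖) ^ 2 / 2) := by
      rw [hl₀]; field_simp
    rw [h3, mul_assoc]
    gcongr 1 + _ * ?_
    refine le_trans ?_ (hexp2 z)
    rw [mul_assoc 2, two_mul, Real.exp_add]
    gcongr
  have hK : ∫ z, (Real.exp (l * ‖g z - m‖) - l * ‖g z - m‖) ∂P
      ≤ Real.exp (l ^ 2 * bernsteinProxy V B) := by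
    have hI2 := hIdom.const_mul (l ^ 2 * (2 * (4 * B) ^ 2))
    have h1 := integral_mono_of_nonneg
      (Filter.Eventually.of_forall fun z => (by
        simp only [Pi.zero_apply]; linarith [Real.add_one_le_exp (l * ‖g z - m‖)] :
        (0 : Z → ℝ) z ≤ Real.exp (l * ‖g z - m‖) - l * ‖g z - m‖))
      ((integrable_const 1).add hI2) (Filter.Eventually.of_forall hpt)
    refine h1.trans ?_
    have h2 : ∫ z, (1 + l ^ 2 * (2 * (4 * B) ^ 2) *
        (Real.exp ((1 + V) / (2 * B)) * Real.exp (‖g z‖ / (2 * B)))) ∂P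
        = 1 + l ^ 2 * (2 * (4 * B) ^ 2) * (Real.exp ((1 + V) / (2 * B)) *
          ∫ z, Real.exp (‖g z‖ / (2 * B)) ∂P) := by
      rw [integral_add (integrable_const 1) hI2, integral_const_mul, integral_const_mul]
      simp
    have h3 : 1 + l ^ 2 * (2 * (4 * B) ^ 2) * (Real.exp ((1 + V) / (2 * B)) *
          ∫ z, Real.exp (‖g z‖ / (2 * B)) ∂P) ≤ 1 + l ^ 2 * bernsteinProxy V B := by
      unfold bernsteinProxy
      rw [mul_assoc (l ^ 2), ← mul_assoc (2 * (4 * B) ^ 2)]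
      gcongr
      exact h.integral_exp_le hm hV
    have h4 := Real.add_one_le_exp (l ^ 2 * bernsteinProxy V B)
    calc _ = _ := h2
      _ ≤ _ := by linarith
  refine (measure_mono fun S hS => ?_).trans ((measure_le_norm_sum_le (P := P)
    (ξ := fun z => g z - m) (hm.sub_const _) ?_ hlpos he hK n
    (n * (bernsteinFactor V B * T / √n))).trans (ENNReal.ofReal_le_ofReal ?_))
  · exact lt_norm_sum_of_lt_norm_deviation hn hS
  · rw [integral_sub hi (integrable_const _)]; simp [hmdef]
  -- The summand `proxy / (4 * B)` of `bernsteinFactor` cancels the quadratic term, and `12 * B`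
  -- times `l₀` leaves the 3.
  · have : (n : ℝ) * (l ^ 2 * bernsteinProxy V B) - l * (n * (bernsteinFactor V B * T / √n))
        = - (3 * T ^ 2) := by
      unfold bernsteinFactor
      rw [hl, hl₀, ← hsq]; field_simp; rw [Real.sqrt_sq hsn.le]; ring
    rw [this]

end Deviation

/-! ### Packing and nets -/

section Nets

variable {E : Type*} [NormedAddCommGroup E] [NormedSpace ℝ E] [FiniteDimensional ℝ E]

/-- Volume comparison: the balls of radius `r / 2` around the points are disjoint and lie in a ball
of radius `ρ + r / 2`. -/
lemma card_le_of_separated_of_subset_closedBall (s : Finset E) (x₀ : E) {ρ r : ℝ}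
    (hρ : 0 ≤ ρ) (hr : 0 < r)
    (hs : ∀ c ∈ s, ‖c - x₀‖ ≤ ρ) (h : ∀ c ∈ s, ∀ d ∈ s, c ≠ d → r ≤ ‖c - d‖) :
    (s.card : ℝ) ≤ (2 * ρ / r + 1) ^ Module.finrank ℝ E := by
  borelize E
  let μ : Measure E := Measure.addHaar
  set D := Module.finrank ℝ E
  have hdisj : Set.PairwiseDisjoint (s : Set E) (fun c => Metric.ball c (r / 2)) := by
    intro c hc d hd hcd
    apply Metric.ball_disjoint_ball
    rw [dist_eq_norm]
    linarith [h c hc d hd hcd]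
  have hsub : (⋃ c ∈ s, Metric.ball c (r / 2)) ⊆ Metric.ball x₀ (ρ + r / 2) := by
    refine Set.iUnion₂_subset fun x hx => Metric.ball_subset_ball' ?_
    rw [dist_eq_norm]
    linarith [hs x hx]
  have hle := measure_mono (μ := μ) hsub
  rw [measure_biUnion_finset hdisj fun c _ => measurableSet_ball] at hle
  simp only [μ.addHaar_ball_of_pos _ (half_pos hr),
    μ.addHaar_ball_of_pos _ (by positivity : 0 < ρ + r / 2), Finset.sum_const, nsmul_eq_mul,
    ← mul_assoc] at hle
  have h2 := (ENNReal.mul_le_mul_iff_left (Metric.measure_ball_pos _ _ zero_lt_one).ne'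
    measure_ball_lt_top.ne).1 hle
  have h3 := ENNReal.toReal_le_of_le_ofReal (by positivity) h2
  rw [ENNReal.toReal_mul, ENNReal.toReal_natCast, ENNReal.toReal_ofReal (by positivity)] at h3
  have e : 2 * ρ / r + 1 = (ρ + r / 2) / (r / 2) := by field_simp
  rw [e, div_pow, le_div_iff₀ (by positivity)]
  exact h3

/-- A separated subset of maximal cardinality, which exists by the packing bound, is a net: an
uncovered point could be added to it. -/
lemma exists_finset_cover (X : Set E) (x₀ : E) {ρ r : ℝ} (hρ : 0 ≤ ρ) (hr : 0 < r)
    (hX : X ⊆ Metric.closedBall x₀ ρ) :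
    ∃ s : Finset E, ↑s ⊆ X ∧ (s.card : ℝ) ≤ (2 * ρ / r + 1) ^ Module.finrank ℝ E ∧
      ∀ x ∈ X, ∃ v ∈ s, ‖x - v‖ ≤ r := by
  classical
  have hball : ∀ x ∈ X, ‖x - x₀‖ ≤ ρ := fun x hx => by
    simpa [dist_eq_norm] using hX hx
  let p : ℕ → Prop := fun m => ∃ s : Finset E, ↑s ⊆ X ∧
    (∀ c ∈ s, ∀ d ∈ s, c ≠ d → r ≤ ‖c - d‖) ∧ s.card = m
  have hbd : ∀ m, p m → (m : ℝ) ≤ (2 * ρ / r + 1) ^ Module.finrank ℝ E := by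
    rintro m ⟨s, hs, hsep, rfl⟩
    exact card_le_of_separated_of_subset_closedBall s x₀ hρ hr (fun c hc => hball c (hs hc)) hsep
  set M := ⌊(2 * ρ / r + 1) ^ Module.finrank ℝ E⌋₊
  have hM : ∀ m, p m → m ≤ M := fun m hm => Nat.le_floor (hbd m hm)
  have h0 : p 0 := ⟨∅, by simp⟩
  obtain ⟨s, hs, hsep, hcard⟩ := Nat.findGreatest_spec (P := p) (Nat.zero_le M) h0
  refine ⟨s, hs, card_le_of_separated_of_subset_closedBall s x₀ hρ hr
    (fun c hc => hball c (hs hc)) hsep, fun x hx => ?_⟩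
  by_contra! hcon
  have hxs : x ∉ s := fun hxs => by
    have := hcon x hxs
    simp at this
    linarith
  have hp : p (s.card + 1) := by
    refine ⟨insert x s, ?_, ?_, Finset.card_insert_of_notMem hxs⟩
    · rw [Finset.coe_insert]
      exact Set.insert_subset hx hs
    · intro c hc d hd hcd
      rcases Finset.mem_insert.1 hc with rfl | hc' <;> rcases Finset.mem_insert.1 hd with rfl | hd'
      · exact absurd rfl hcd
      · exact (hcon d hd').le
      · rw [norm_sub_rev]; exact (hcon c hc').le
      · exact hsep c hc' d hd' hcd
  have := Nat.le_findGreatest (hM _ hp) hp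
  omega

/-- Dyadic nets starting from the centre of the ball. -/
lemma exists_dyadic_nets {X : Set E} {x₀ : E} (hx₀ : x₀ ∈ X) {ρ : ℝ} (hρ : 0 < ρ)
    (hX : X ⊆ Metric.closedBall x₀ ρ) :
    ∃ N : ℕ → Finset E, N 0 = {x₀} ∧ (∀ k, ↑(N k) ⊆ X) ∧
      (∀ k, ((N k).card : ℝ) ≤ (2 ^ (k + 2)) ^ Module.finrank ℝ E) ∧
      ∀ k, ∀ x ∈ X, ∃ v ∈ N k, ‖x - v‖ ≤ ρ / 2 ^ k := by
  choose N hN using fun k : ℕ =>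
    exists_finset_cover X x₀ hρ.le (by positivity : 0 < ρ / 2 ^ k) hX
  -- Level 0 is replaced by the centre alone, so that every chain ends at `x₀`. The cardinality
  -- bound uses `2 * 2 ^ k + 1 ≤ 2 ^ (k + 2)`.
  refine ⟨fun k => if k = 0 then {x₀} else N k, by simp, fun k => ?_, fun k => ?_, fun k => ?_⟩
  · by_cases hk : k = 0 <;> simp [hk, hx₀, (hN k).1]
  · by_cases hk : k = 0
    · simp only [hk, if_true, Finset.card_singleton, Nat.cast_one]
      exact one_le_pow₀ (by norm_num)
    · simp only [hk, if_false]
      refine (hN k).2.1.trans (pow_le_pow_left₀ (by positivity) ?_ _)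
      have e : 2 * ρ / (ρ / 2 ^ k) = 2 * 2 ^ k := by field_simp
      rw [e, pow_add]
      have : (1 : ℝ) ≤ 2 ^ k := one_le_pow₀ (by norm_num)
      linarith
  · by_cases hk : k = 0
    · subst hk
      intro x hx
      refine ⟨x₀, by simp, ?_⟩
      simpa [dist_eq_norm] using hX hx
    · simpa [hk] using (hN k).2.2

end Nets

/-! ### Chaining -/

lemma sum_succ_div_two_pow_le (m : ℕ) :
    ∑ j ∈ Finset.range m, ((j : ℝ) + 1) / 2 ^ j ≤ 4 := by
  have h : ∑ j ∈ Finset.range m, ((j : ℝ) + 1) / 2 ^ j = 4 - 2 * (m + 2) / 2 ^ m := by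
    induction m with
    | zero => norm_num
    | succ m ih =>
      rw [Finset.sum_range_succ, ih, pow_succ]
      push_cast
      field_simp
      ring
  rw [h]
  have : (0 : ℝ) ≤ 2 * (m + 2) / 2 ^ m := by positivity
  linarith

/-- Union bound over one level. The entropy is at most `(k + 3) * q`, while the tail exponent `9 *
(k + 1) ^ 2 * q` also pays for `3 * q` and for the `k + 1` that makes the levels summable. -/
lemma chaining_tail_le {d k : ℕ} {q : ℝ} (hq1 : 1 ≤ q) (hd : (d : ℝ) ≤ q) :
    (2 ^ (k + 1 + 2)) ^ d * (2 * Real.exp (-(3 * (k + 1) * √q) ^ 2))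
      ≤ 2 * Real.exp (-(3 * q)) * (1 / 2) ^ (k + 1) := by
  have h2 : (2 : ℝ) ≤ Real.exp 1 := by linarith [Real.add_one_le_exp 1]
  have h1 : ((2 : ℝ) ^ (k + 1 + 2)) ^ d ≤ Real.exp ((k + 3) * d) := by
    rw [← pow_mul]
    refine (pow_le_pow_left₀ (by norm_num) h2 _).trans_eq ?_
    rw [← Real.exp_nat_mul]
    congr 1
    push_cast
    ring
  have h3 : ((1 : ℝ) / 2) ^ (k + 1) ≥ Real.exp (-(k + 1)) := by
    have : Real.exp (-1) ≤ 1 / 2 := by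
      rw [Real.exp_neg, one_div]
      gcongr
    refine (pow_le_pow_left₀ (Real.exp_pos _).le this (k + 1)).trans_eq' ?_
    rw [← Real.exp_nat_mul]
    congr 1
    push_cast
    ring
  have hsq : (3 * ((k : ℝ) + 1) * √q) ^ 2 = 9 * (k + 1) ^ 2 * q := by
    rw [mul_pow, Real.sq_sqrt (by linarith)]; ring
  have hk : (0 : ℝ) ≤ k := Nat.cast_nonneg k
  calc (2 ^ (k + 1 + 2)) ^ d * (2 * Real.exp (-(3 * (k + 1) * √q) ^ 2))
      ≤ Real.exp ((k + 3) * d) * (2 * Real.exp (-(3 * (k + 1) * √q) ^ 2)) := by gcongr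
    _ = 2 * Real.exp ((k + 3) * d - 9 * (k + 1) ^ 2 * q) := by
        rw [hsq, sub_eq_add_neg, Real.exp_add]; ring
    _ ≤ 2 * Real.exp (-(3 * q) + -(k + 1)) := by
        gcongr
        have h4 : ((k : ℝ) + 3) * d ≤ (k + 3) * q := by gcongr
        have h5 : ((k : ℝ) + 1) * 1 ≤ (k + 1) * q := by gcongr
        nlinarith [mul_nonneg hk hk, mul_nonneg hk (by linarith : 0 ≤ q),
          mul_nonneg (mul_nonneg hk hk) (by linarith : 0 ≤ q)]
    _ ≤ _ := by
        rw [Real.exp_add, ← mul_assoc]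
        gcongr

section Uniform

variable {E : Type*} [NormedAddCommGroup E] [NormedSpace ℝ E] [FiniteDimensional ℝ E]
  {H : Type*} [NormedAddCommGroup H] [InnerProductSpace ℝ H]
  [CompleteSpace H] [MeasurableSpace H] [BorelSpace H] [SecondCountableTopology H]
  {Z : Type*} [MeasurableSpace Z] {P : Measure Z} [IsProbabilityMeasure P]

/-- Uniform deviation bound for a Lipschitz random field, by chaining. -/
lemma exists_uniform_deviation {X : Set E} {x₀ : E} (hx₀ : x₀ ∈ X) {ρ : ℝ} (hρ : 0 < ρ)
    (hX : X ⊆ Metric.closedBall x₀ ρ) {h : E → Z → H} (hm : ∀ x ∈ X, Measurable (h x))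
    {L : ℝ} (hL : 0 < L) (hlip : ∀ x ∈ X, ∀ x' ∈ X, ∀ z, ‖h x z - h x' z‖ ≤ L * ‖x - x'‖)
    {B V : ℝ} (hB : BernsteinCondition P (h x₀) B) (hV : ∫ z, ‖h x₀ z‖ ^ 2 ∂P ≤ V)
    {n : ℕ} {q : ℝ} (hq1 : 1 ≤ q) (hd : (Module.finrank ℝ E : ℝ) ≤ q) (hqn : q ≤ n) :
    ∃ A : Set (Fin n → Z), MeasurableSet A ∧
      Measure.pi (fun _ : Fin n => P) Aᶜ ≤ ENNReal.ofReal (4 * Real.exp (-(3 * q))) ∧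
      ∀ S ∈ A, ∀ x ∈ X,
        ‖deviation P S (h x)‖ ≤ (bernsteinFactor V B + 98 * (L * ρ)) * √(q / n) := by
  have hn' : (0 : ℝ) < n := by linarith
  have hn : 0 < n := by exact_mod_cast hn'
  have hsn : 0 < √(n : ℝ) := Real.sqrt_pos.2 hn'
  have hsq1 : 1 ≤ √q := Real.one_le_sqrt.2 hq1
  have hint0 : Integrable (h x₀) P :=
    (integrable_norm_iff (hm x₀ hx₀).aestronglyMeasurable).1 (hB.integrable_norm (hm x₀ hx₀))
  have hint : ∀ x ∈ X, Integrable (h x) P := fun x hx => by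
    have : Integrable (fun z => h x z - h x₀ z) P :=
      Integrable.of_bound ((hm x hx).sub (hm x₀ hx₀)).aestronglyMeasurable (L * ‖x - x₀‖)
        (Filter.Eventually.of_forall fun z => hlip x hx x₀ hx₀ z)
    refine (this.add hint0).congr (Filter.Eventually.of_forall fun z => ?_)
    simp
  have hdev : ∀ (S : Fin n → Z), ∀ x ∈ X, ∀ x' ∈ X, deviation P S (fun z => h x z - h x' z)
      = deviation P S (h x) - deviation P S (h x') := fun S x hx x' hx' =>
    deviation_sub S (hint x hx) (hint x' hx')
  obtain ⟨N, hN0, hNX, hNcard, hNcov⟩ := exists_dyadic_nets hx₀ hρ hX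
  choose! π hπN hπ using hNcov
  -- The Hoeffding threshold `4 * b * T / √n` with `b = L * ρ / 2 ^ k` and `T = 3 * (k + 1) * √q`
  -- equals `a * ((k + 1) / 2 ^ k)`.
  set a := 12 * (L * ρ) * √q / √n with ha
  have ha0 : 0 ≤ a := by positivity
  let bad₀ : Set (Fin n → Z) := {S | bernsteinFactor V B * √q / √n < ‖deviation P S (h x₀)‖}
  let bad : ℕ → E → Set (Fin n → Z) := fun k v =>
    {S | a * ((k + 1) / 2 ^ k) < ‖deviation P S (fun z => h v z - h (π k v) z)‖}
  have hmeas₀ : MeasurableSet bad₀ :=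
    measurableSet_lt measurable_const (measurable_deviation (hm x₀ hx₀)).norm
  have hmeas : ∀ k, ∀ v ∈ N (k + 1), MeasurableSet (bad k v) := fun k v hv =>
    measurableSet_lt measurable_const (measurable_deviation
      ((hm v (hNX _ hv)).sub (hm _ (hNX _ (hπN k v (hNX _ hv)))))).norm
  have hp₀ : Measure.pi (fun _ : Fin n => P) bad₀ ≤ ENNReal.ofReal (2 * Real.exp (-(3 * q))) := by
    have := hB.measure_lt_norm_deviation (hm x₀ hx₀) hV (n := n) (T := √q) (by positivity)
      (Real.sqrt_le_sqrt hqn)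
    rwa [Real.sq_sqrt (by linarith)] at this
  have hp : ∀ k, ∀ v ∈ N (k + 1), Measure.pi (fun _ : Fin n => P) (bad k v)
      ≤ ENNReal.ofReal (2 * Real.exp (-(3 * (k + 1) * √q) ^ 2)) := fun k v hv => by
    have hvX := hNX _ hv
    have hwX := hNX _ (hπN k v hvX)
    have := measure_lt_norm_deviation_of_bounded (P := P) (g := fun z => h v z - h (π k v) z)
      ((hm v hvX).sub (hm _ hwX)) (b := L * (ρ / 2 ^ k)) (by positivity)
      (fun z => (hlip v hvX _ hwX z).trans (by gcongr; exact hπ k v hvX)) hn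
      (T := 3 * (k + 1) * √q) (by positivity)
    have e : 4 * (L * (ρ / 2 ^ k)) * (3 * (k + 1) * √q) / √n = a * ((k + 1) / 2 ^ k) := by
      rw [ha]; ring
    rwa [e] at this
  -- The chain stops at level `n`: since `2 ^ n ≥ √n`, the remaining increment is within the rate
  -- for every sample.
  set Bad := bad₀ ∪ ⋃ k ∈ Finset.range n, ⋃ v ∈ N (k + 1), bad k v with hBad
  have hBadmeas : MeasurableSet Bad := hmeas₀.union
    (Finset.measurableSet_biUnion _ fun k _ => Finset.measurableSet_biUnion _ fun v hv =>
      hmeas k v hv)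
  refine ⟨Badᶜ, hBadmeas.compl, ?_, fun S hS x hx => ?_⟩
  · rw [compl_compl]
    have hlevel : ∀ k, Measure.pi (fun _ : Fin n => P) (⋃ v ∈ N (k + 1), bad k v)
        ≤ ENNReal.ofReal (2 * Real.exp (-(3 * q)) * (1 / 2) ^ (k + 1)) := fun k => by
      refine (measure_biUnion_finset_le _ _).trans ((Finset.sum_le_sum (hp k)).trans ?_)
      rw [Finset.sum_const, nsmul_eq_mul, ← ENNReal.ofReal_natCast,
        ← ENNReal.ofReal_mul (by positivity)]
      refine ENNReal.ofReal_le_ofReal (le_trans ?_ (chaining_tail_le hq1 hd))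
      gcongr
      exact_mod_cast hNcard (k + 1)
    have hsum : ∑ k ∈ Finset.range n, ((1 : ℝ) / 2) ^ (k + 1) ≤ 1 := by
      have := summable_geometric_two.sum_le_tsum (Finset.range n) (fun _ _ => by positivity)
      rw [tsum_geometric_two] at this
      simp_rw [pow_succ]
      rw [← Finset.sum_mul]
      linarith
    calc Measure.pi (fun _ : Fin n => P) Bad
        ≤ Measure.pi (fun _ : Fin n => P) bad₀ + Measure.pi (fun _ : Fin n => P)
          (⋃ k ∈ Finset.range n, ⋃ v ∈ N (k + 1), bad k v) := measure_union_le _ _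
      _ ≤ ENNReal.ofReal (2 * Real.exp (-(3 * q))) + ∑ k ∈ Finset.range n,
          ENNReal.ofReal (2 * Real.exp (-(3 * q)) * (1 / 2) ^ (k + 1)) :=
          add_le_add hp₀ ((measure_biUnion_finset_le _ _).trans
            (Finset.sum_le_sum fun k _ => hlevel k))
      _ = ENNReal.ofReal (2 * Real.exp (-(3 * q)) + ∑ k ∈ Finset.range n,
          2 * Real.exp (-(3 * q)) * (1 / 2) ^ (k + 1)) := by
          rw [← ENNReal.ofReal_sum_of_nonneg fun k _ => by positivity,
            ← ENNReal.ofReal_add (by positivity) (Finset.sum_nonneg fun k _ => by positivity)]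
      _ ≤ _ := by
          refine ENNReal.ofReal_le_ofReal ?_
          rw [← Finset.mul_sum]
          nlinarith [Real.exp_pos (-(3 * q))]
  · simp only [hBad, Set.compl_union, Set.compl_iUnion, Set.mem_inter_iff, Set.mem_iInter,
      Finset.mem_range] at hS
    obtain ⟨hS₀, hS⟩ := hS
    have hS₀ : ‖deviation P S (h x₀)‖ ≤ bernsteinFactor V B * √q / √n := not_lt.1 hS₀
    have hS : ∀ k < n, ∀ v ∈ N (k + 1), ‖deviation P S (h v) - deviation P S (h (π k v))‖
        ≤ a * ((k + 1) / 2 ^ k) := fun k hk v hv => by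
      rw [← hdev S v (hNX _ hv) _ (hNX _ (hπN k v (hNX _ hv)))]
      exact not_lt.1 (hS k hk v hv)
    have hchain : ∀ k ≤ n, ∀ v ∈ N k, ‖deviation P S (h v) - deviation P S (h x₀)‖
        ≤ a * ∑ j ∈ Finset.range k, ((j : ℝ) + 1) / 2 ^ j := by
      intro k
      induction k with
      | zero =>
        intro _ v hv
        rw [hN0, Finset.mem_singleton] at hv
        simp [hv]
      | succ k ih =>
        intro hk v hv
        have h1 := hS k (by omega) v hv
        have h2 := ih (by omega) (π k v) (hπN k v (hNX _ hv))
        rw [Finset.sum_range_succ, mul_add]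
        have h3 := norm_sub_le_norm_sub_add_norm_sub (deviation P S (h v))
          (deviation P S (h (π k v))) (deviation P S (h x₀))
        linarith
    set v := π n x
    have hvX := hNX _ (hπN n x hx)
    have h1 := hchain n le_rfl v (hπN n x hx)
    have h2 : ‖deviation P S (h x) - deviation P S (h v)‖ ≤ 2 * (L * (ρ / 2 ^ n)) := by
      rw [← hdev S x hx v hvX]
      exact norm_deviation_le hn S fun z => (hlip x hx v hvX z).trans (by gcongr; exact hπ n x hx)
    have h3 : L * (ρ / 2 ^ n) ≤ L * ρ * √q / √n := by
      have hle : √(n : ℝ) ≤ 2 ^ n := by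
        have h4 : (n : ℝ) ≤ 2 ^ n := by exact_mod_cast Nat.lt_two_pow_self.le
        refine (Real.sqrt_le_iff.2 ⟨hn'.le, by
          have : (1 : ℝ) ≤ n := by exact_mod_cast hn
          nlinarith⟩).trans h4
      calc L * (ρ / 2 ^ n) = L * ρ * 1 / 2 ^ n := by ring
        _ ≤ L * ρ * √q / √n := by gcongr
    have h4 := sum_succ_div_two_pow_le n
    have h5 : a * ∑ j ∈ Finset.range n, ((j : ℝ) + 1) / 2 ^ j ≤ a * 4 := by gcongr
    have h6 := norm_le_norm_add_norm_sub' (deviation P S (h x)) (deviation P S (h x₀))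
    have h7 := norm_sub_le_norm_sub_add_norm_sub (deviation P S (h x))
      (deviation P S (h v)) (deviation P S (h x₀))
    -- The links cost `4 * a`, that is 48, and the last increment 2, in units of `L * ρ * √q / √n`;
    -- 98 is generous.
    have e : (bernsteinFactor V B + 98 * (L * ρ)) * √(q / n)
        = bernsteinFactor V B * √q / √n + a * 4 + 50 * (L * ρ * √q / √n) := by
      rw [Real.sqrt_div (by linarith), ha]; ring
    rw [e]
    have h8 : 0 ≤ L * ρ * √q / √n := by positivity
    linarith

end Uniform

lemma primal_eq_of_isMaxOn {E E' : Type*} {Y : Set E'} {G : E → E' → ℝ} {x : E} {y : E'} (hy : y ∈ Y) (h : IsMaxOn (G x) Y y) :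
    primal Y G x = G x y :=
  IsGreatest.csSup_eq ⟨⟨y, hy, rfl⟩, by rintro _ ⟨y', hy', rfl⟩; exact h hy'⟩

/-! ### Gradient inequalities on `X × Y` -/

section Gradients

variable {E E' : Type*} [NormedAddCommGroup E] [InnerProductSpace ℝ E]
  [NormedAddCommGroup E'] [InnerProductSpace ℝ E']
  {X : Set E} {Y : Set E'}

/-- The properties of a function `G` with gradient `(gx, gy)` on `X × Y` from which the regularity
of the primal function is derived: a quadratic first-order expansion, Lipschitz continuity of the
gradient, and strong monotonicity of `-gy` in the second variable. -/
structure SmoothStronglyConcave (X : Set E) (Y : Set E') (G : E → E' → ℝ) (gx : E → E' → E)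
    (gy : E → E' → E') (μ β : ℝ) : Prop where
  expansion : ∀ x ∈ X, ∀ x' ∈ X, ∀ y ∈ Y, ∀ y' ∈ Y,
    |G x' y' - G x y - inner ℝ (gx x y) (x' - x) - inner ℝ (gy x y) (y' - y)|
      ≤ 2 * β * (‖x' - x‖ + ‖y' - y‖) ^ 2
  lipschitz_x : ∀ x ∈ X, ∀ x' ∈ X, ∀ y ∈ Y, ∀ y' ∈ Y,
    ‖gx x y - gx x' y'‖ ≤ β * (‖x - x'‖ + ‖y - y'‖)
  lipschitz_y : ∀ x ∈ X, ∀ x' ∈ X, ∀ y ∈ Y, ∀ y' ∈ Y,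
    ‖gy x y - gy x' y'‖ ≤ β * (‖x - x'‖ + ‖y - y'‖)
  monotone_y : ∀ x ∈ X, ∀ y ∈ Y, ∀ y' ∈ Y,
    inner ℝ (gy x y - gy x y') (y - y') ≤ -(μ * ‖y - y'‖ ^ 2)

lemma sqrt_add_sq_le_add {a b : ℝ} (ha : 0 ≤ a) (hb : 0 ≤ b) : √(a ^ 2 + b ^ 2) ≤ a + b :=
  Real.sqrt_le_iff.2 ⟨by positivity, by nlinarith [mul_nonneg ha hb]⟩

lemma GradientLipschitzOn.norm_sub_le_left {hx : E → E' → E} {hy : E → E' → E'} {β : ℝ}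
    (hβ : 0 ≤ β) (h : GradientLipschitzOn X Y hx hy β) {x x' : E} {y y' : E'} (hxX : x ∈ X)
    (hx' : x' ∈ X) (hyY : y ∈ Y) (hy' : y' ∈ Y) :
    ‖hx x y - hx x' y'‖ ≤ β * (‖x - x'‖ + ‖y - y'‖) :=
  calc ‖hx x y - hx x' y'‖ ≤ √(‖hx x y - hx x' y'‖ ^ 2 + ‖hy x y - hy x' y'‖ ^ 2) :=
        Real.le_sqrt_of_sq_le (by linarith [sq_nonneg ‖hy x y - hy x' y'‖])
    _ ≤ _ := h x hxX x' hx' y hyY y' hy'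
    _ ≤ _ := by gcongr; exact sqrt_add_sq_le_add (norm_nonneg _) (norm_nonneg _)

lemma GradientLipschitzOn.norm_sub_le_right {hx : E → E' → E} {hy : E → E' → E'} {β : ℝ}
    (hβ : 0 ≤ β) (h : GradientLipschitzOn X Y hx hy β) {x x' : E} {y y' : E'} (hxX : x ∈ X)
    (hx' : x' ∈ X) (hyY : y ∈ Y) (hy' : y' ∈ Y) :
    ‖hy x y - hy x' y'‖ ≤ β * (‖x - x'‖ + ‖y - y'‖) :=
  calc ‖hy x y - hy x' y'‖ ≤ √(‖hx x y - hx x' y'‖ ^ 2 + ‖hy x y - hy x' y'‖ ^ 2) :=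
        Real.le_sqrt_of_sq_le (by linarith [sq_nonneg ‖hx x y - hx x' y'‖])
    _ ≤ _ := h x hxX x' hx' y hyY y' hy'
    _ ≤ _ := by gcongr; exact sqrt_add_sq_le_add (norm_nonneg _) (norm_nonneg _)

lemma StronglyConcaveGrad.inner_sub_le {g : E' → ℝ} {g' : E' → E'} {μ : ℝ}
    (h : StronglyConcaveGrad Y g g' μ) {y y' : E'} (hy : y ∈ Y) (hy' : y' ∈ Y) :
    inner ℝ (g' y - g' y') (y - y') ≤ -(μ * ‖y - y'‖ ^ 2) := by
  have h1 := h y hy y' hy'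
  have h2 := h y' hy' y hy
  rw [norm_sub_rev y' y, ← neg_sub y y', inner_neg_right] at h2
  rw [inner_sub_left]
  simp only [inner_neg_left] at h1 h2
  linarith

/-- Mean value inequality along the segment, which convexity keeps inside `X × Y`, for `g` minus its
linearization. The factor 2 adds the variations of the two partial gradients. -/
lemma HasPartialGradientsOn.abs_expansion_le (hX : Convex ℝ X) (hY : Convex ℝ Y)
    {g : E → E' → ℝ} {hx : E → E' → E} {hy : E → E' → E'} {β : ℝ} (hβ : 0 ≤ β)
    (hg : HasPartialGradientsOn X Y g hx hy) (hl : GradientLipschitzOn X Y hx hy β)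
    {x x' : E} {y y' : E'} (hxX : x ∈ X) (hx' : x' ∈ X) (hyY : y ∈ Y) (hy' : y' ∈ Y) :
    |g x' y' - g x y - inner ℝ (hx x y) (x' - x) - inner ℝ (hy x y) (y' - y)|
      ≤ 2 * β * (‖x' - x‖ + ‖y' - y‖) ^ 2 := by
  set T : E × E' → (E × E' →L[ℝ] ℝ) := fun p =>
    (innerSL ℝ (hx p.1 p.2)).comp (ContinuousLinearMap.fst ℝ E E')
      + (innerSL ℝ (hy p.1 p.2)).comp (ContinuousLinearMap.snd ℝ E E') with hT
  have hsub : segment ℝ (x, y) (x', y') ⊆ X ×ˢ Y :=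
    (hX.prod hY).segment_subset ⟨hxX, hyY⟩ ⟨hx', hy'⟩
  have hder : ∀ p ∈ segment ℝ (x, y) (x', y'),
      HasFDerivWithinAt (fun p : E × E' => g p.1 p.2) (T p) (segment ℝ (x, y) (x', y')) p :=
    fun p hp => (hg p.1 (hsub hp).1 p.2 (hsub hp).2).mono hsub
  have hbound : ∀ p ∈ segment ℝ (x, y) (x', y'),
      ‖T p - T (x, y)‖ ≤ 2 * β * (‖x' - x‖ + ‖y' - y‖) := by
    intro p hp
    have hpXY := hsub hp
    rw [segment_eq_image'] at hp
    obtain ⟨θ, ⟨hθ0, hθ1⟩, rfl⟩ := hp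
    set p : E × E' := (x, y) + θ • ((x', y') - (x, y)) with hp
    have e1 : p.1 - x = θ • (x' - x) := by simp [hp]
    have e2 : p.2 - y = θ • (y' - y) := by simp [hp]
    have n1 : ‖p.1 - x‖ ≤ ‖x' - x‖ := by
      rw [e1, norm_smul, Real.norm_of_nonneg hθ0]
      exact mul_le_of_le_one_left (norm_nonneg _) hθ1
    have n2 : ‖p.2 - y‖ ≤ ‖y' - y‖ := by
      rw [e2, norm_smul, Real.norm_of_nonneg hθ0]
      exact mul_le_of_le_one_left (norm_nonneg _) hθ1
    have m1 : ‖hx p.1 p.2 - hx x y‖ ≤ β * (‖x' - x‖ + ‖y' - y‖) :=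
      (hl.norm_sub_le_left hβ hpXY.1 hxX hpXY.2 hyY).trans (by gcongr)
    have m2 : ‖hy p.1 p.2 - hy x y‖ ≤ β * (‖x' - x‖ + ‖y' - y‖) :=
      (hl.norm_sub_le_right hβ hpXY.1 hxX hpXY.2 hyY).trans (by gcongr)
    refine ContinuousLinearMap.opNorm_le_bound _ (by positivity) fun w => ?_
    have e3 : (T p - T (x, y)) w
        = inner ℝ (hx p.1 p.2 - hx x y) w.1 + inner ℝ (hy p.1 p.2 - hy x y) w.2 := by
      simp [hT, inner_sub_left]; ring
    rw [e3]
    have i1 := (norm_inner_le_norm (𝕜 := ℝ) (hx p.1 p.2 - hx x y) w.1).trans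
      (mul_le_mul m1 (norm_fst_le w) (norm_nonneg _) (by positivity))
    have i2 := (norm_inner_le_norm (𝕜 := ℝ) (hy p.1 p.2 - hy x y) w.2).trans
      (mul_le_mul m2 (norm_snd_le w) (norm_nonneg _) (by positivity))
    refine (norm_add_le _ _).trans ?_
    linarith
  have h := Convex.norm_image_sub_le_of_norm_hasFDerivWithin_le' hder hbound
    (convex_segment _ _) (left_mem_segment ℝ _ _) (right_mem_segment ℝ _ _)
  have e : (T (x, y)) ((x', y') - (x, y)) =
      inner ℝ (hx x y) (x' - x) + inner ℝ (hy x y) (y' - y) := by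
    simp [hT]
  rw [e, Real.norm_eq_abs, ← sub_sub] at h
  refine h.trans ?_
  have hn : ‖((x', y') - (x, y) : E × E')‖ ≤ ‖x' - x‖ + ‖y' - y‖ := by
    rw [Prod.mk_sub_mk, Prod.norm_mk]
    exact max_le_add_of_nonneg (norm_nonneg _) (norm_nonneg _)
  calc _ ≤ 2 * β * (‖x' - x‖ + ‖y' - y‖) * (‖x' - x‖ + ‖y' - y‖) := by gcongr
    _ = _ := by ring

/-! ### Population and empirical averages -/

section Population

variable [CompleteSpace E] [MeasurableSpace E] [BorelSpace E] [SecondCountableTopology E]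
  [CompleteSpace E'] [MeasurableSpace E'] [BorelSpace E'] [SecondCountableTopology E']
  {Z : Type*} [MeasurableSpace Z] {P : Measure Z} [IsProbabilityMeasure P]
  {f : E → E' → Z → ℝ} {fx : E → E' → Z → E} {fy : E → E' → Z → E'} {μ β : ℝ}

omit [CompleteSpace E] [CompleteSpace E'] [BorelSpace E'] [SecondCountableTopology E'] in
lemma IsNCSC.integrable_fx (h : IsNCSC P X Y f fx fy μ β) (hβ : 0 ≤ β) {x₀ : E} {y₀ : E'}
    (hx₀ : x₀ ∈ X) (hy₀ : y₀ ∈ Y) (hi : Integrable (fx x₀ y₀) P) {x : E} {y : E'} (hx : x ∈ X)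
    (hy : y ∈ Y) : Integrable (fx x y) P := by
  have : Integrable (fun z => fx x y z - fx x₀ y₀ z) P :=
    Integrable.of_bound ((h.measurable_fx x hx y hy).sub
      (h.measurable_fx x₀ hx₀ y₀ hy₀)).aestronglyMeasurable (β * (‖x - x₀‖ + ‖y - y₀‖))
      (Filter.Eventually.of_forall fun z => (h.smooth z).norm_sub_le_left hβ hx hx₀ hy hy₀)
  refine (this.add hi).congr (Filter.Eventually.of_forall fun z => ?_)
  simp

omit [CompleteSpace E] [BorelSpace E] [SecondCountableTopology E] [CompleteSpace E'] in
lemma IsNCSC.integrable_fy (h : IsNCSC P X Y f fx fy μ β) (hβ : 0 ≤ β) {x₀ : E} {y₀ : E'}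
    (hx₀ : x₀ ∈ X) (hy₀ : y₀ ∈ Y) (hi : Integrable (fy x₀ y₀) P) {x : E} {y : E'} (hx : x ∈ X)
    (hy : y ∈ Y) : Integrable (fy x y) P := by
  have : Integrable (fun z => fy x y z - fy x₀ y₀ z) P :=
    Integrable.of_bound ((h.measurable_fy x hx y hy).sub
      (h.measurable_fy x₀ hx₀ y₀ hy₀)).aestronglyMeasurable (β * (‖x - x₀‖ + ‖y - y₀‖))
      (Filter.Eventually.of_forall fun z => (h.smooth z).norm_sub_le_right hβ hx hx₀ hy hy₀)
  refine (this.add hi).congr (Filter.Eventually.of_forall fun z => ?_)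
  simp

omit [BorelSpace E] [SecondCountableTopology E] [BorelSpace E'] [SecondCountableTopology E'] in
-- Every property in the structure is an inequality that survives averaging, so there is no
-- differentiation under the integral sign.
lemma IsNCSC.smoothStronglyConcave (h : IsNCSC P X Y f fx fy μ β) (hβ : 0 ≤ β)
    (hix : ∀ x ∈ X, ∀ y ∈ Y, Integrable (fx x y) P)
    (hiy : ∀ x ∈ X, ∀ y ∈ Y, Integrable (fy x y) P) :
    SmoothStronglyConcave X Y (popRisk P f) (fun x y => ∫ z, fx x y z ∂P)
      (fun x y => ∫ z, fy x y z ∂P) μ β where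
  expansion x hx x' hx' y hy y' hy' := by
    have i1 := h.integrable_f x' hx' y' hy'
    have i2 := h.integrable_f x hx y hy
    have i3 : Integrable (fun z => inner ℝ (fx x y z) (x' - x)) P := (hix x hx y hy).inner_const _
    have i4 : Integrable (fun z => inner ℝ (fy x y z) (y' - y)) P := (hiy x hx y hy).inner_const _
    have i12 : Integrable (fun z => f x' y' z - f x y z) P := i1.sub i2
    have i123 : Integrable (fun z => f x' y' z - f x y z - inner ℝ (fx x y z) (x' - x)) P :=
      i12.sub i3
    have e : popRisk P f x' y' - popRisk P f x y - inner ℝ (∫ z, fx x y z ∂P) (x' - x)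
        - inner ℝ (∫ z, fy x y z ∂P) (y' - y)
        = ∫ z, (f x' y' z - f x y z - inner ℝ (fx x y z) (x' - x)
          - inner ℝ (fy x y z) (y' - y)) ∂P := by
      rw [integral_sub i123 i4, integral_sub i12 i3, integral_sub i1 i2]
      simp only [real_inner_comm (x' - x), real_inner_comm (y' - y)]
      rw [integral_inner (hix x hx y hy), integral_inner (hiy x hx y hy)]
      rfl
    rw [e, ← Real.norm_eq_abs]
    have hb : ∀ z, ‖f x' y' z - f x y z - inner ℝ (fx x y z) (x' - x)
        - inner ℝ (fy x y z) (y' - y)‖ ≤ 2 * β * (‖x' - x‖ + ‖y' - y‖) ^ 2 := fun z =>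
      (h.hasGradients z).abs_expansion_le h.convex_X h.convex_Y hβ (h.smooth z) hx hx' hy hy'
    simpa using norm_integral_le_of_norm_le_const (μ := P) (Filter.Eventually.of_forall hb)
  lipschitz_x x hx x' hx' y hy y' hy' := by
    rw [← integral_sub (hix x hx y hy) (hix x' hx' y' hy')]
    simpa using norm_integral_le_of_norm_le_const (μ := P) (Filter.Eventually.of_forall fun z =>
      (h.smooth z).norm_sub_le_left hβ hx hx' hy hy')
  lipschitz_y x hx x' hx' y hy y' hy' := by
    rw [← integral_sub (hiy x hx y hy) (hiy x' hx' y' hy')]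
    simpa using norm_integral_le_of_norm_le_const (μ := P) (Filter.Eventually.of_forall fun z =>
      (h.smooth z).norm_sub_le_right hβ hx hx' hy hy')
  monotone_y x hx y hy y' hy' := by
    have i : Integrable (fun z => fy x y z - fy x y' z) P :=
      (hiy x hx y hy).sub (hiy x hx y' hy')
    rw [← integral_sub (hiy x hx y hy) (hiy x hx y' hy'), real_inner_comm,
      ← integral_inner i]
    have := integral_mono (i.const_inner (y - y')) (integrable_const _) fun z => by
      have := (h.stronglyConcave z x hx).inner_sub_le hy hy'
      rwa [real_inner_comm] at this
    simpa using this

/-- The uniform probability measure on `Fin n`. -/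
noncomputable def uniformFin (n : ℕ) : Measure (Fin n) := (n : ENNReal)⁻¹ • Measure.count

omit [BorelSpace E] [SecondCountableTopology E] [MeasurableSpace E] in
lemma integral_uniformFin {n : ℕ} (g : Fin n → E) :
    ∫ i, g i ∂(uniformFin n) = (n : ℝ)⁻¹ • ∑ i, g i := by
  rw [uniformFin, integral_smul_measure, integral_count]
  simp

lemma isProbabilityMeasure_uniformFin {n : ℕ} (hn : 0 < n) :
    IsProbabilityMeasure (uniformFin n) := by
  refine ⟨?_⟩
  rw [uniformFin, Measure.smul_apply, Measure.count_univ]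
  simp only [ENat.card_eq_coe_fintype_card, Fintype.card_fin, smul_eq_mul, ENat.toENNReal_coe]
  exact ENNReal.inv_mul_cancel (by simpa using hn.ne') (ENNReal.natCast_ne_top n)

omit [BorelSpace E] [SecondCountableTopology E] [BorelSpace E'] [SecondCountableTopology E']
  [IsProbabilityMeasure P] in
-- The empirical risk is the population risk for the uniform measure on the sample indices.
lemma IsNCSC.smoothStronglyConcave_empRisk (h : IsNCSC P X Y f fx fy μ β) (hβ : 0 ≤ β) {n : ℕ}
    (hn : 0 < n) (S : Fin n → Z) :
    SmoothStronglyConcave X Y (empRisk S f) (fun x y => (n : ℝ)⁻¹ • ∑ i, fx x y (S i))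
      (fun x y => (n : ℝ)⁻¹ • ∑ i, fy x y (S i)) μ β := by
  have := isProbabilityMeasure_uniformFin hn
  have hS : IsNCSC (uniformFin n) X Y (fun x y i => f x y (S i)) (fun x y i => fx x y (S i))
      (fun x y i => fy x y (S i)) μ β :=
    { compact_X := h.compact_X
      convex_X := h.convex_X
      compact_Y := h.compact_Y
      convex_Y := h.convex_Y
      hasGradients := fun i => h.hasGradients (S i)
      smooth := fun i => h.smooth (S i)
      stronglyConcave := fun i => h.stronglyConcave (S i)
      measurable_fx := fun _ _ _ _ => measurable_of_finite _
      measurable_fy := fun _ _ _ _ => measurable_of_finite _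
      measurable_f := fun _ _ _ _ => measurable_of_finite _
      integrable_f := fun _ _ _ _ => Integrable.of_finite }
  have key := hS.smoothStronglyConcave hβ (fun _ _ _ _ => Integrable.of_finite)
    (fun _ _ _ _ => Integrable.of_finite)
  have e : popRisk (uniformFin n) (fun x y i => f x y (S i)) = empRisk S f := by
    funext x y
    rw [popRisk, integral_uniformFin, empRisk, one_div, smul_eq_mul]
  simp only [integral_uniformFin, e] at key
  exact key

end Population

/-! ### Stability of maximizers and Danskin's theorem -/

/-- Comparison of the maximizers `y₁`, `y₂` of two functions: `a` and `b` are the gradients of the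
first at `y₁` and `y₂`, and `c` is that of the second at `y₂`. Adding the two variational
inequalities to strong monotonicity leaves only `b - c`. -/
lemma norm_sub_le_of_inner_le {a b c y₁ y₂ : E'} {μ : ℝ}
    (h : inner ℝ (a - b) (y₁ - y₂) ≤ -(μ * ‖y₁ - y₂‖ ^ 2))
    (ha : inner ℝ a (y₂ - y₁) ≤ 0) (hc : inner ℝ c (y₁ - y₂) ≤ 0) :
    μ * ‖y₁ - y₂‖ ≤ ‖b - c‖ := by
  rcases (norm_nonneg (y₁ - y₂)).eq_or_lt with h0 | h0
  · rw [← h0, mul_zero]; exact norm_nonneg _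
  have h1 := real_inner_le_norm (b - c) (y₁ - y₂)
  rw [← neg_sub y₁ y₂, inner_neg_right] at ha
  rw [inner_sub_left] at h h1
  refine le_of_mul_le_mul_right ?_ h0
  nlinarith

section Maximizers

variable {G : E → E' → ℝ} {gx : E → E' → E} {gy : E → E' → E'} {μ β : ℝ}

lemma SmoothStronglyConcave.inner_le_zero (h : SmoothStronglyConcave X Y G gx gy μ β)
    (hβ : 0 ≤ β) (hY : Convex ℝ Y) {x : E} {y y' : E'} (hx : x ∈ X) (hy : y ∈ Y)
    (hmax : IsMaxOn (G x) Y y) (hy' : y' ∈ Y) : inner ℝ (gy x y) (y' - y) ≤ 0 := by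
  by_contra! hc
  set c := inner ℝ (gy x y) (y' - y) with hcdef
  set K := 2 * β * ‖y' - y‖ ^ 2 with hK
  have hK0 : 0 ≤ K := by positivity
  -- A step `θ` gains at least `θ * c - θ ^ 2 * K`, which is positive since `θ * K < c`; this
  -- contradicts maximality.
  set θ := c / (c + K + 1) with hθ
  have hθ0 : 0 < θ := by positivity
  have hθ1 : θ ≤ 1 := (div_le_one (by positivity)).2 (by linarith)
  have hmem : y + θ • (y' - y) ∈ Y := hY.add_smul_sub_mem hy hy' ⟨hθ0.le, hθ1⟩
  have h1 := (abs_le.1 (h.expansion x hx x hx y hy _ hmem)).1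
  have h2 : G x (y + θ • (y' - y)) ≤ G x y := hmax hmem
  rw [sub_self, inner_zero_right, norm_zero, add_sub_cancel_left, inner_smul_right, norm_smul,
    Real.norm_of_nonneg hθ0.le] at h1
  have h3 : θ * c ≤ θ * (θ * K) := by
    rw [hK, hcdef]
    nlinarith
  have h4 : c ≤ θ * K := le_of_mul_le_mul_left h3 hθ0
  have h5 : θ * K * (c + K + 1) = c * K := by rw [hθ]; field_simp
  have h6 : c * (c + K + 1) ≤ c * K := by rw [← h5]; gcongr
  nlinarith

lemma SmoothStronglyConcave.exists_isMaxOn (h : SmoothStronglyConcave X Y G gx gy μ β)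
    (hY : IsCompact Y) (hne : Y.Nonempty) {x : E} (hx : x ∈ X) :
    ∃ y ∈ Y, IsMaxOn (G x) Y y := by
  refine hY.exists_isMaxOn hne fun y hy => ?_
  rw [ContinuousWithinAt, tendsto_iff_norm_sub_tendsto_zero]
  have hb : ∀ y' ∈ Y, ‖G x y' - G x y‖ ≤ ‖gy x y‖ * ‖y' - y‖ + 2 * β * ‖y' - y‖ ^ 2 := by
    intro y' hy'
    have h1 := h.expansion x hx x hx y hy y' hy'
    rw [sub_self, inner_zero_right, norm_zero, sub_zero, zero_add] at h1
    have h2 := norm_inner_le_norm (𝕜 := ℝ) (gy x y) (y' - y)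
    have h3 := norm_le_norm_add_norm_sub' (G x y' - G x y) (inner ℝ (gy x y) (y' - y))
    rw [← Real.norm_eq_abs] at h1
    linarith
  have hlim : Filter.Tendsto (fun y' : E' => ‖gy x y‖ * ‖y' - y‖ + 2 * β * ‖y' - y‖ ^ 2)
      (nhdsWithin y Y) (nhds 0) := by
    have hc : Continuous fun y' : E' => ‖gy x y‖ * ‖y' - y‖ + 2 * β * ‖y' - y‖ ^ 2 := by fun_prop
    have := (hc.tendsto y).mono_left (nhdsWithin_le_nhds (s := Y))
    simpa using this
  refine squeeze_zero' (Filter.Eventually.of_forall fun _ => norm_nonneg _) ?_ hlim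
  filter_upwards [self_mem_nhdsWithin] with y' hy' using hb y' hy'

/-- The two functions compared are `G x₁` and `G x₂`, whose gradients at `y₂` differ by at most `β *
‖x₁ - x₂‖`. For `x₁ = x₂` this is uniqueness of the maximizer. -/
lemma SmoothStronglyConcave.norm_maximizer_sub_le (h : SmoothStronglyConcave X Y G gx gy μ β)
    (hβ : 0 ≤ β) (hμ : 0 < μ) (hY : Convex ℝ Y) {x₁ x₂ : E} {y₁ y₂ : E'} (hx₁ : x₁ ∈ X)
    (hx₂ : x₂ ∈ X) (hy₁ : y₁ ∈ Y) (hy₂ : y₂ ∈ Y) (h₁ : IsMaxOn (G x₁) Y y₁)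
    (h₂ : IsMaxOn (G x₂) Y y₂) : ‖y₁ - y₂‖ ≤ β / μ * ‖x₁ - x₂‖ := by
  have h3 := norm_sub_le_of_inner_le (h.monotone_y x₁ hx₁ y₁ hy₁ y₂ hy₂)
    (h.inner_le_zero hβ hY hx₁ hy₁ h₁ hy₂) (h.inner_le_zero hβ hY hx₂ hy₂ h₂ hy₁)
  have h4 := h.lipschitz_y x₁ hx₁ x₂ hx₂ y₂ hy₂ y₂ hy₂
  rw [sub_self, norm_zero, add_zero] at h4
  rw [div_mul_eq_mul_div, le_div_iff₀ hμ]
  linarith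

/-- Danskin's theorem for a strongly concave inner problem. -/
lemma SmoothStronglyConcave.hasGradientAt_primal [CompleteSpace E]
    (h : SmoothStronglyConcave X Y G gx gy μ β) (hβ : 0 ≤ β) (hμ : 0 < μ) (hYc : IsCompact Y)
    (hY : Convex ℝ Y) {x : E} {y : E'} (hx : x ∈ interior X) (hy : y ∈ Y)
    (hmax : IsMaxOn (G x) Y y) : HasGradientAt (primal Y G) (gx x y) x := by
  have hxX := interior_subset hx
  set K := β * (β / μ) + 2 * β with hK
  have hb : ∀ x' ∈ X, ‖primal Y G x' - primal Y G x - inner ℝ (gx x y) (x' - x)‖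
      ≤ K * ‖‖x' - x‖ ^ 2‖ := by
    intro x' hx'
    obtain ⟨y', hy', hmax'⟩ := h.exists_isMaxOn hYc ⟨y, hy⟩ hx'
    rw [primal_eq_of_isMaxOn hy hmax, primal_eq_of_isMaxOn hy' hmax', Real.norm_eq_abs,
      Real.norm_of_nonneg (sq_nonneg _)]
    -- Moving `x` with `y` frozen bounds the increment of the primal function from below; with `y'`
    -- frozen, from above. Replacing `gx x y'` by `gx x y` then costs `β * (β / μ) * ‖x' - x‖ ^ 2`,
    -- by stability of the maximizer.
    have h1 := (abs_le.1 (h.expansion x hxX x' hx' y hy y hy)).1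
    have h2 := (abs_le.1 (h.expansion x hxX x' hx' y' hy' y' hy')).2
    rw [sub_self, inner_zero_right, norm_zero, sub_zero, add_zero] at h1 h2
    have h3 : G x' y ≤ G x' y' := hmax' hy
    have h4 : G x y' ≤ G x y := hmax hy'
    have h5 := h.norm_maximizer_sub_le hβ hμ hY hx' hxX hy' hy hmax' hmax
    have h6 := h.lipschitz_x x hxX x hxX y' hy' y hy
    rw [sub_self, norm_zero, zero_add] at h6
    have h7 := real_inner_le_norm (gx x y' - gx x y) (x' - x)
    rw [inner_sub_left] at h7
    have h8 : ‖gx x y' - gx x y‖ * ‖x' - x‖ ≤ β * (β / μ * ‖x' - x‖) * ‖x' - x‖ := by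
      gcongr
      exact h6.trans (by gcongr)
    have h9 : 0 ≤ β * (β / μ) * ‖x' - x‖ ^ 2 := by positivity
    rw [hK, abs_le]
    constructor <;> linarith
  have hO : (fun x' => primal Y G x' - primal Y G x - inner ℝ (gx x y) (x' - x))
      =O[nhds x] fun x' => ‖x' - x‖ ^ 2 :=
    Asymptotics.IsBigO.of_bound K
      (Filter.eventually_of_mem (mem_interior_iff_mem_nhds.1 hx) hb)
  have hd := hO.hasFDerivAt (𝕜 := ℝ) one_lt_two
  have hd2 : HasFDerivAt (fun x' => primal Y G x + inner ℝ (gx x y) (x' - x))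
      (innerSL ℝ (gx x y)) x := by
    have := ((innerSL ℝ (gx x y)).hasFDerivAt (x := x)).sub_const (inner ℝ (gx x y) x)
    simpa [inner_sub_right] using this.const_add (primal Y G x)
  rw [hasGradientAt_iff_hasFDerivAt]
  have hd3 := hd.add hd2
  rw [zero_add] at hd3
  refine (hd3.congr_of_eventuallyEq (Filter.Eventually.of_forall fun x' => ?_)).congr_fderiv ?_
  · simp
  · ext v; simp

end Maximizers

end Gradients

/-! ### Assembly of the theorem -/

section Main

variable {E E' : Type*} [NormedAddCommGroup E] [InnerProductSpace ℝ E]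
  [NormedAddCommGroup E'] [InnerProductSpace ℝ E'] [CompleteSpace E] {X : Set E} {Y : Set E'}

/-- The population gradient at an interior empirical solution is controlled by the deviations of
the empirical gradients at the population maximizer. -/
lemma norm_gradient_primal_le {F G : E → E' → ℝ} {Fx Gx : E → E' → E} {Fy Gy : E → E' → E'}
    {μ β : ℝ} (hF : SmoothStronglyConcave X Y F Fx Fy μ β)
    (hG : SmoothStronglyConcave X Y G Gx Gy μ β) (hβ : 0 ≤ β) (hμ : 0 < μ) (hYc : IsCompact Y)
    (hY : Convex ℝ Y) {x : E} {y y' : E'} (hx : x ∈ interior X) (hy : y ∈ Y)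
    (hmax : IsMaxOn (F x) Y y) (hsol : IsMinimaxSolution X Y G x y') :
    ‖gradient (primal Y F) x‖ ≤ ‖Gx x y - Fx x y‖ + β / μ * ‖Gy x y - Fy x y‖ := by
  obtain ⟨hxX, hy', hmax', hmin⟩ := hsol
  rw [(hF.hasGradientAt_primal hβ hμ hYc hY hx hy hmax).gradient]
  -- Danskin's theorem for `G` together with Fermat's rule at the interior minimizer.
  have hG0 : Gx x y' = 0 := by
    have h1 := (hG.hasGradientAt_primal hβ hμ hYc hY hx hy' hmax').hasFDerivAt
    have h2 := (hmin.isLocalMin (mem_interior_iff_mem_nhds.1 hx)).hasFDerivAt_eq_zero h1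
    simpa using h2
  -- Both gradients are compared at the population maximizer `y`, which depends on `x` only, and not
  -- at the sample-dependent `y'`.
  have h1 := norm_sub_le_of_inner_le (hG.monotone_y x hxX y' hy' y hy)
    (hG.inner_le_zero hβ hY hxX hy' hmax' hy) (hF.inner_le_zero hβ hY hxX hy hmax hy')
  have h2 := hG.lipschitz_x x hxX x hxX y' hy' y hy
  rw [sub_self, norm_zero, zero_add, hG0, zero_sub, norm_neg] at h2
  have h3 : ‖y' - y‖ ≤ ‖Gy x y - Fy x y‖ / μ := by
    rw [le_div_iff₀ hμ]; linarith
  have h4 : β * ‖y' - y‖ ≤ β / μ * ‖Gy x y - Fy x y‖ := by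
    calc β * ‖y' - y‖ ≤ β * (‖Gy x y - Fy x y‖ / μ) := by gcongr
      _ = _ := by ring
  have h5 := norm_le_norm_add_norm_sub (Gx x y) (Fx x y)
  linarith

end Main

/-- Two fields, for `∇ₓ` and `∇_y`, each fail with probability at most `4 * exp (-(3 * q))`; the
factor 8 is absorbed by `exp 3 ≥ 8` as `d ≥ 1`. -/
lemma eight_mul_exp_le {d q δ : ℝ} (hd : 1 ≤ d) (hδ : 0 < δ) (hδ1 : δ < 1)
    (hq : q = d - Real.log δ) : 8 * Real.exp (-(3 * q)) ≤ δ := by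
  have hlog : Real.log δ < 0 := Real.log_neg hδ hδ1
  have h1 : Real.exp (-(3 * q)) ≤ Real.exp (-3) * δ := by
    calc Real.exp (-(3 * q)) ≤ Real.exp (-3 + Real.log δ) := Real.exp_le_exp.2 (by linarith)
      _ = _ := by rw [Real.exp_add, Real.exp_log hδ]
  have h2 : (8 : ℝ) ≤ Real.exp 3 := by
    have h3 : (2 : ℝ) ≤ Real.exp 1 := by linarith [Real.add_one_le_exp 1]
    have h4 : Real.exp 3 = Real.exp 1 ^ 3 := by rw [← Real.exp_nat_mul]; norm_num
    rw [h4]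
    calc (8 : ℝ) = 2 ^ 3 := by norm_num
      _ ≤ _ := by gcongr
  have h5 : 8 * Real.exp (-3) ≤ 1 := by
    rw [Real.exp_neg, ← div_eq_mul_inv]
    exact (div_le_one (Real.exp_pos 3)).2 h2
  nlinarith

/-- For `n ≥ 2` the iterated logarithm is at least `-1 / 2`, so `d ≥ 1` keeps the right-hand side
comparable to `q`. -/
lemma sqrt_div_le_two_mul_sqrt {d q δ : ℝ} (hd : 1 ≤ d) (hδ : 0 < δ) (hδ1 : δ < 1)
    (hq : q = d - Real.log δ) {n : ℕ} (hn : 2 ≤ n) :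
    √(q / n) ≤ 2 * √((d + Real.log (Real.log n / δ)) / n) := by
  have hlog : Real.log δ < 0 := Real.log_neg hδ hδ1
  have hn' : (0 : ℝ) < n := by positivity
  have hlog2 : Real.log 2 ≤ Real.log n := Real.log_le_log (by norm_num) (by exact_mod_cast hn)
  have h2 : 0.6931 < Real.log 2 := by linarith [Real.log_two_gt_d9]
  have hpos : 0 < Real.log n := by linarith
  have h3 : -(1 / 2 : ℝ) ≤ Real.log (Real.log n) := by
    have h4 := Real.one_sub_inv_le_log_of_pos hpos
    have h5 : (Real.log n)⁻¹ ≤ 3 / 2 := by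
      rw [inv_le_comm₀ hpos (by norm_num)]
      linarith
    linarith
  have h6 : Real.log (Real.log n / δ) = Real.log (Real.log n) - Real.log δ :=
    Real.log_div hpos.ne' hδ.ne'
  have h7 : q / n ≤ 2 ^ 2 * ((d + Real.log (Real.log n / δ)) / n) := by
    rw [← mul_div_assoc]
    gcongr
    rw [hq, h6]
    linarith
  refine (Real.sqrt_le_sqrt h7).trans_eq ?_
  rw [Real.sqrt_mul (by positivity), Real.sqrt_sq (by norm_num)]

/-- The constant `C` depends only on `β`, `μ` (that is, `μ_y`), the radius `R` of `X` around `x*`,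
the Bernstein parameters `Bx`, `By`, and bounds `Vx`, `Vy` on the second moments of the gradients
at `(x*, y*)`. -/
theorem theorem3 (β μ R Vx Vy Bx By : ℝ) (hβ : 0 < β) (hμ : 0 < μ) :
    ∃ C : ℝ, 0 < C ∧
      ∀ (d d' : ℕ) (Z : Type*) [MeasurableSpace Z] (P : Measure Z) [IsProbabilityMeasure P]
        (X : Set (EuclideanSpace ℝ (Fin d))) (Y : Set (EuclideanSpace ℝ (Fin d')))
        (f : EuclideanSpace ℝ (Fin d) → EuclideanSpace ℝ (Fin d') → Z → ℝ)
        (fx : EuclideanSpace ℝ (Fin d) → EuclideanSpace ℝ (Fin d') → Z →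
          EuclideanSpace ℝ (Fin d))
        (fy : EuclideanSpace ℝ (Fin d) → EuclideanSpace ℝ (Fin d') → Z →
          EuclideanSpace ℝ (Fin d'))
        (xs : EuclideanSpace ℝ (Fin d)) (ys : EuclideanSpace ℝ (Fin d')),
        IsNCSC P X Y f fx fy μ β →
        IsMinimaxSolution X Y (popRisk P f) xs ys →
        X ⊆ Metric.closedBall xs R →
        BernsteinCondition P (fx xs ys) Bx →
        BernsteinCondition P (fy xs ys) By →
        ∫ z, ‖fx xs ys z‖ ^ 2 ∂P ≤ Vx →
        ∫ z, ‖fy xs ys z‖ ^ 2 ∂P ≤ Vy →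
        ∀ (n : ℕ), 2 ≤ n → ∀ (δ : ℝ), 0 < δ → δ < 1 →
          ∃ A : Set (Fin n → Z), MeasurableSet A ∧
            ENNReal.ofReal (1 - δ) ≤ Measure.pi (fun _ : Fin n => P) A ∧
            ∀ S ∈ A, ∀ (xhat : EuclideanSpace ℝ (Fin d)) (yhat : EuclideanSpace ℝ (Fin d')),
              IsMinimaxSolution X Y (empRisk S f) xhat yhat →
              xhat ∈ interior X →
              DifferentiableAt ℝ (primal Y (popRisk P f)) xhat ∧
              ‖gradient (primal Y (popRisk P f)) xhat‖
                ≤ C * √(((d : ℝ) + Real.log (Real.log n / δ)) / n) := by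
  -- `R` is an arbitrary real here, whereas the nets need a positive radius.
  set ρ := max R 1 with hρ
  have hρ0 : 0 < ρ := lt_max_of_lt_right one_pos
  -- Lipschitz constant of the gradients along the graph of the maximizer map.
  set L := β * (1 + β / μ) with hL
  have hL0 : 0 < L := by positivity
  set Cx := bernsteinFactor Vx Bx + 98 * (L * ρ) with hCx
  set Cy := bernsteinFactor Vy By + 98 * (L * ρ) with hCy
  -- The second summand serves `q ≤ n`, the third `q > n`. Absolute values appear because no sign of
  -- `Vx`, `Vy`, `Bx`, `By` is known when the constant is chosen.
  set C₁ := 1 + |Cx + β / μ * Cy| + |1 + Vx + L * ρ| with hC₁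
  have hC₁0 : 0 < C₁ := by positivity
  refine ⟨C₁ * 2, by positivity, ?_⟩
  intro d d' Z _ P _ X Y f fx fy xs ys hN hsol hXR hBx hBy hVx hVy n hn δ hδ hδ1
  obtain ⟨hxs, hys, hysmax, -⟩ := hsol
  have hn0 : 0 < n := by omega
  have hXρ : X ⊆ Metric.closedBall xs ρ :=
    hXR.trans (Metric.closedBall_subset_closedBall (le_max_left _ _))
  have hint0x : Integrable (fx xs ys) P :=
    (integrable_norm_iff (hN.measurable_fx xs hxs ys hys).aestronglyMeasurable).1
      (hBx.integrable_norm (hN.measurable_fx xs hxs ys hys))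
  have hint0y : Integrable (fy xs ys) P :=
    (integrable_norm_iff (hN.measurable_fy xs hxs ys hys).aestronglyMeasurable).1
      (hBy.integrable_norm (hN.measurable_fy xs hxs ys hys))
  have hF := hN.smoothStronglyConcave hβ.le
    (fun x hx y hy => hN.integrable_fx hβ.le hxs hys hint0x hx hy)
    (fun x hx y hy => hN.integrable_fy hβ.le hxs hys hint0y hx hy)
  have hY := hN.convex_Y
  have hYc := hN.compact_Y
  choose! m hmY hmax using fun x (hx : x ∈ X) => hF.exists_isMaxOn hYc ⟨ys, hys⟩ hx
  have hdiff : ∀ x ∈ interior X, HasGradientAt (primal Y (popRisk P f)) (∫ z, fx x (m x) z ∂P) x :=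
    fun x hx => hF.hasGradientAt_primal hβ.le hμ hYc hY hx (hmY x (interior_subset hx))
      (hmax x (interior_subset hx))
  -- For `d = 0` the logarithm may be negative, but the gradient lives in a trivial space.
  rcases Nat.eq_zero_or_pos d with rfl | hd
  · refine ⟨Set.univ, MeasurableSet.univ, ?_, fun S _ xhat yhat _ hx =>
      ⟨(hdiff xhat hx).differentiableAt, ?_⟩⟩
    · rw [measure_univ]
      exact ENNReal.ofReal_le_one.2 (by linarith)
    · rw [Subsingleton.elim (gradient (primal Y (popRisk P f)) xhat) 0, norm_zero]
      positivity
  have hd1 : (1 : ℝ) ≤ d := by exact_mod_cast hd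
  have hlog : Real.log δ < 0 := Real.log_neg hδ hδ1
  obtain ⟨q, hq⟩ : ∃ q, q = (d : ℝ) - Real.log δ := ⟨_, rfl⟩
  have hfinal : ∀ a : ℝ, a ≤ C₁ * √(q / n) →
      a ≤ C₁ * 2 * √(((d : ℝ) + Real.log (Real.log n / δ)) / n) := fun a ha => by
    rw [mul_assoc]
    exact ha.trans (by gcongr; exact sqrt_div_le_two_mul_sqrt hd1 hδ hδ1 hq hn)
  have hn' : (0 : ℝ) < n := by exact_mod_cast hn0
  have hmlip : ∀ x ∈ X, ∀ x' ∈ X, ‖x - x'‖ + ‖m x - m x'‖ ≤ (1 + β / μ) * ‖x - x'‖ :=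
    fun x hx x' hx' => by
      have := hF.norm_maximizer_sub_le hβ.le hμ hY hx hx' (hmY x hx) (hmY x' hx')
        (hmax x hx) (hmax x' hx')
      linarith
  -- Uniqueness of the maximizer places the Bernstein condition at the centre of the chaining.
  have hms : m xs = ys := by
    have := hF.norm_maximizer_sub_le hβ.le hμ hY hxs hxs (hmY xs hxs) hys (hmax xs hxs) hysmax
    rw [sub_self, norm_zero, mul_zero] at this
    exact sub_eq_zero.1 (norm_le_zero_iff.1 this)
  -- The sub-Gaussian range needs `√q ≤ √n`. Otherwise `√(q / n) ≥ 1`, and the gradient is bounded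
  -- by its value at `(x*, y*)` plus its variation `L * ρ`.
  rcases le_or_gt q n with hqn | hqn
  · have hfin : (Module.finrank ℝ (EuclideanSpace ℝ (Fin d)) : ℝ) ≤ q := by
      rw [finrank_euclideanSpace_fin]; linarith
    obtain ⟨A₁, hA₁, hP₁, hdev₁⟩ := exists_uniform_deviation (P := P) hxs hρ0 hXρ
      (h := fun x => fx x (m x)) (fun x hx => hN.measurable_fx x hx _ (hmY x hx)) hL0
      (fun x hx x' hx' z => by
        refine ((hN.smooth z).norm_sub_le_left hβ.le hx hx' (hmY x hx) (hmY x' hx')).trans ?_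
        rw [hL, mul_assoc]
        exact mul_le_mul_of_nonneg_left (hmlip x hx x' hx') hβ.le)
      (B := Bx) (V := Vx) (by simpa only [hms] using hBx) (by simpa only [hms] using hVx)
      (q := q) (by linarith) hfin hqn
    obtain ⟨A₂, hA₂, hP₂, hdev₂⟩ := exists_uniform_deviation (P := P) hxs hρ0 hXρ
      (h := fun x => fy x (m x)) (fun x hx => hN.measurable_fy x hx _ (hmY x hx)) hL0
      (fun x hx x' hx' z => by
        refine ((hN.smooth z).norm_sub_le_right hβ.le hx hx' (hmY x hx) (hmY x' hx')).trans ?_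
        rw [hL, mul_assoc]
        exact mul_le_mul_of_nonneg_left (hmlip x hx x' hx') hβ.le)
      (B := By) (V := Vy) (by simpa only [hms] using hBy) (by simpa only [hms] using hVy)
      (q := q) (by linarith) hfin hqn
    refine ⟨A₁ ∩ A₂, hA₁.inter hA₂, ?_, fun S hS xhat yhat hsolhat hx =>
      ⟨(hdiff xhat hx).differentiableAt, hfinal _ ?_⟩⟩
    · have hcompl : Measure.pi (fun _ : Fin n => P) (A₁ ∩ A₂)ᶜ ≤ ENNReal.ofReal δ := by
        rw [Set.compl_inter]
        refine (measure_union_le _ _).trans ((add_le_add hP₁ hP₂).trans ?_)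
        rw [← ENNReal.ofReal_add (by positivity) (by positivity)]
        refine ENNReal.ofReal_le_ofReal ?_
        linarith [eight_mul_exp_le hd1 hδ hδ1 hq]
      have h1 := prob_compl_eq_one_sub (μ := Measure.pi (fun _ : Fin n => P))
        (hA₁.inter hA₂).compl
      rw [compl_compl] at h1
      rw [h1, ENNReal.ofReal_sub _ hδ.le, ENNReal.ofReal_one]
      exact tsub_le_tsub_left hcompl 1
    · have hxX := interior_subset hx
      have h1 := norm_gradient_primal_le hF (hN.smoothStronglyConcave_empRisk hβ.le hn0 S) hβ.le
        hμ hYc hY hx (hmY xhat hxX) (hmax xhat hxX) hsolhat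
      have h2 := hdev₁ S hS.1 xhat hxX
      have h3 := hdev₂ S hS.2 xhat hxX
      unfold deviation at h2 h3
      calc _ ≤ Cx * √(q / n) + β / μ * (Cy * √(q / n)) := by
            refine h1.trans (add_le_add h2 ?_)
            gcongr
        _ = (Cx + β / μ * Cy) * √(q / n) := by ring
        _ ≤ C₁ * √(q / n) := by
            gcongr
            rw [hC₁]
            linarith [le_abs_self (Cx + β / μ * Cy), abs_nonneg (1 + Vx + L * ρ)]
  · refine ⟨Set.univ, MeasurableSet.univ, ?_, fun S _ xhat yhat _ hx =>
      ⟨(hdiff xhat hx).differentiableAt, hfinal _ ?_⟩⟩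
    · rw [measure_univ]
      exact ENNReal.ofReal_le_one.2 (by linarith)
    · have hxX := interior_subset hx
      have hq1 : 1 ≤ √(q / n) := Real.one_le_sqrt.2 ((one_le_div hn').2 hqn.le)
      rw [(hdiff xhat hx).gradient]
      have h1 : ‖∫ z, fx xs ys z ∂P‖ ≤ 1 + Vx :=
        (norm_integral_le_integral_norm _).trans
          (hBx.integral_norm_le (hN.measurable_fx xs hxs ys hys) hVx)
      have h2 := hF.lipschitz_x xhat hxX xs hxs (m xhat) (hmY xhat hxX) ys hys
      have h3 := hmlip xhat hxX xs hxs
      rw [hms] at h3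
      have h4 : ‖xhat - xs‖ ≤ ρ := by simpa [dist_eq_norm] using hXρ hxX
      have h5 : β * (‖xhat - xs‖ + ‖m xhat - ys‖) ≤ L * ρ := by
        calc β * (‖xhat - xs‖ + ‖m xhat - ys‖) ≤ β * ((1 + β / μ) * ρ) := by
              gcongr
              exact h3.trans (by gcongr)
          _ = _ := by rw [hL]; ring
      have h6 := norm_le_norm_add_norm_sub' (∫ z, fx xhat (m xhat) z ∂P) (∫ z, fx xs ys z ∂P)
      calc _ ≤ 1 + Vx + L * ρ := by linarith
        _ ≤ C₁ * 1 := by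
            rw [hC₁]
            linarith [le_abs_self (1 + Vx + L * ρ), abs_nonneg (Cx + β / μ * Cy)]
        _ ≤ _ := by gcongr
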